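/- **Theorem (Stability).** Let $d,N\ge 1$ be integers, let $\Omega\subset\mathbb R^d$ be a non-empty, bounded, open set, and let $\Phi_k$ ($k\in\mathbb N$) and $\Phi$ be functions from $\mathbb R^N_+=[0,\infty)^N$ to $[0,\infty)$. *Notation.* All sets are Lebesgue measurable, inclusions hold up to null sets, $|E|$ is the Lebesgue measure and $\mathrm{Per}(E)$ the (De Giorgi) perimeter of $E$. An $N$-set of $\Omega$ is an $N$-tuple $\mathcal E=(\mathcal E_1,\dots,\mathcal E_N)$ with $\mathcal E_i\subset\Omega$, $|\mathcal E_i|>0$ and $|\mathcal E_i\cap\mathcal E_j|=0$ for $i\ne j$; it is an $N$-cluster if moreover $\mathrm{Per}(\mathcal E_i)<\infty$ for all $i$. For $F\subset\mathbb R^d$ and $1<p<\infty$ put $$BV_0(F)=\{u\in BV(\mathbb R^d): u=0 \text{ a.e. in } \mathbb R^d\setminus F\},\qquad W^{1,p}_0(F)=\{u\in W^{1,p}(\mathbb R^d): u=0 \text{ a.e. in } \mathbb R^d\setminus F\},$$ $$h(F)=\inf\Big\{\tfrac{\mathrm{Per}(E)}{|E|}: E\subset F,\ |E|>0\Big\},\qquad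 \lambda_{1,p}(F)=\inf\Big\{\int_F|\nabla u|^p\,dx: u\in W^{1,p}_0(F),\ \|u\|_{L^p}=1\Big\},$$ with values in $[0,\infty]$. A $(1,N)$-function (resp. a $(p,N)$-function, $1<p<\infty$) of $\Omega$ is an $N$-tuple $u=(u_1,\dots,u_N)$ of functions in $BV_0(\Omega)$ (resp. in $W^{1,p}_0(\Omega)$) with $u_i\ge0$, $\|u_i\|_{L^1}=1$ (resp. $\|u_i\|_{L^p}=1$) and $u_iu_j=0$ a.e. in $\Omega$ for $i\neq j$. For $\Psi:\mathbb R^N_+\to[0,\infty)$ define the following elements of $[0,\infty]$: $$H^{\Psi,N}(\Omega)=\inf\Big\{\Psi\Big(\tfrac{\mathrm{Per}(\mathcal E_1)}{|\mathcal E_1|},\dots,\tfrac{\mathrm{Per}(\mathcal E_N)}{|\mathcal E_N|}\Big):\mathcal E \text{ an } N\text{-cluster of }\Omega\Big\},$$ $$\Lambda^{\Psi,N}_{1,1}(\Omega)=\inf\{\Psi(|Du_1|(\mathbb R^d),\dots,|Du_N|(\mathbb R^d)): u \text{ a } (1,N)\text{-function of }\Omega\},$$ $$\Lambda^{\Psi,N}_{1,p}(\Omega)=\inf\{\Psi(\|\nabla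 u_1\|_{L^p}^p,\dots,\|\nabla u_N\|_{L^p}^p): u \text{ a } (p,N)\text{-function of }\Omega\}\quad(1<p<\infty),$$ $$\mathscr L^{\Psi,N}_{1,1}(\Omega)=\inf\{\Psi(h(\mathcal E_1),\dots,h(\mathcal E_N)):\mathcal E\text{ an }N\text{-set of }\Omega\},$$ $$\mathscr L^{\Psi,N}_{1,p}(\Omega)=\inf\{\Psi(\lambda_{1,p}(\mathcal E_1),\dots,\lambda_{1,p}(\mathcal E_N)):\mathcal E\text{ an }N\text{-set of }\Omega\}\quad(1<p<\infty),$$ where $\Psi(v)=\infty$ if some component of $v\in[0,\infty]^N$ is $\infty$. *Assumptions.* (a) $(\Phi_k)$ is equicoercive: there is $\delta>0$ with $\Phi_k(v)\ge\delta\|v\|_1$ for all $k$ and all $v\in\mathbb R^N_+$. (b) $\Phi_k\to\Phi$ pointwise on $\mathbb R^N_+$. (c) $\Phi$ is the $\Gamma$-limit of $(\Phi_k)$ with respect to the Euclidean distance on $\mathbb R^N_+$. (d) $\Phi$ is increasing: $v_i\le w_i$ for all $i$ implies $\Phi(v)\le\Phi(w)$. *Conclusion.* (i) $\lim_{k\to\infty}H^{\Phi_k,N}(\Omega)=H^{\Phi,N}(\Omega)$;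 (ii) $\lim_{k\to\infty}\Lambda^{\Phi_k,N}_{1,p}(\Omega)=\Lambda^{\Phi,N}_{1,p}(\Omega)$ for every $p\in[1,\infty)$; (iii) $\lim_{k\to\infty}\mathscr L^{\Phi_k,N}_{1,p}(\Omega)=\mathscr L^{\Phi,N}_{1,p}(\Omega)$ for every $p\in[1,\infty)$. -/

import Mathlib

open MeasureTheory Filter Topology
open scoped ENNReal NNReal ContDiff

namespace NCheeger

/-! ### Total variation, perimeter, Cheeger constant -/

/-- The divergence `∑ᵢ ∂ᵢ φᵢ` of a vector field on `ℝᵈ`. -/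
noncomputable def divergence {d : ℕ}
    (φ : EuclideanSpace ℝ (Fin d) → EuclideanSpace ℝ (Fin d))
    (x : EuclideanSpace ℝ (Fin d)) : ℝ :=
  ∑ i, (fderiv ℝ φ x (EuclideanSpace.single i 1)) i

/-- The total variation `|Du|(ℝᵈ)`: the supremum of `∫ u div φ` over all vector fields
`φ ∈ C¹_c(ℝᵈ; ℝᵈ)` with `|φ| ≤ 1`. -/
noncomputable def totalVariation {d : ℕ} (u : EuclideanSpace ℝ (Fin d) → ℝ) : ℝ≥0∞ :=
  ⨆ φ : {φ : EuclideanSpace ℝ (Fin d) → EuclideanSpace ℝ (Fin d) //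
      ContDiff ℝ 1 φ ∧ HasCompactSupport φ ∧ ∀ x, ‖φ x‖ ≤ 1},
    ENNReal.ofReal (∫ x, u x * divergence φ.1 x)

/-- The Euclidean (De Giorgi) perimeter of a set. -/
noncomputable def perimeter {d : ℕ} (E : Set (EuclideanSpace ℝ (Fin d))) : ℝ≥0∞ :=
  totalVariation (E.indicator fun _ => (1 : ℝ))

/-- The Cheeger constant `h(F)`: the infimum of `Per(E) / |E|` over the Lebesgue measurable sets
`E` of positive measure that are contained in `F` up to a null set. -/
noncomputable def cheegerConstant {d : ℕ} (F : Set (EuclideanSpace ℝ (Fin d))) : ℝ≥0∞ :=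
  ⨅ E : {E : Set (EuclideanSpace ℝ (Fin d)) //
      NullMeasurableSet E ∧ volume (E \ F) = 0 ∧ 0 < volume E},
    perimeter E.1 / volume E.1

/-! ### `N`-sets and `N`-clusters -/

/-- `N`-sets of `F`: the chambers are Lebesgue measurable, of positive measure, contained in `F`
up to null sets, and pairwise disjoint up to null sets. -/
structure IsNSet {d N : ℕ} (F : Set (EuclideanSpace ℝ (Fin d)))
    (E : Fin N → Set (EuclideanSpace ℝ (Fin d))) : Prop where
  nullMeasurableSet : ∀ i, NullMeasurableSet (E i)
  subset : ∀ i, volume (E i \ F) = 0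
  pos : ∀ i, 0 < volume (E i)
  disjoint : ∀ i j, i ≠ j → volume (E i ∩ E j) = 0

/-- `N`-clusters of `F`: the `N`-sets whose chambers have finite perimeter. -/
structure IsNCluster {d N : ℕ} (F : Set (EuclideanSpace ℝ (Fin d)))
    (E : Fin N → Set (EuclideanSpace ℝ (Fin d))) : Prop extends IsNSet F E where
  perimeter_lt_top : ∀ i, perimeter (E i) < ⊤

/-! ### Reference functions

A reference function is a map `Φ : ℝᴺ₊ → [0, ∞)`, that is `(Fin N → ℝ≥0) → ℝ≥0`; the order on
`Fin N → ℝ≥0` is the component-wise one, its topology is the Euclidean one. -/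

/-- The value of a reference function at a vector with components in `[0, ∞]`: it is `∞` as soon
as a component is `∞`, so that such competitors do not contribute to an infimum. -/
noncomputable def evalExt {N : ℕ} (Φ : (Fin N → ℝ≥0) → ℝ≥0) (v : Fin N → ℝ≥0∞) : ℝ≥0∞ :=
  open Classical in
  if ∀ i, v i ≠ ⊤ then (Φ fun i => (v i).toNNReal : ℝ≥0∞) else ⊤

/-- A sequence of reference functions is equicoercive if `Φₖ(v) ≥ δ ‖v‖₁` for some `δ > 0`
independent of `k`. -/
def Equicoercive {N : ℕ} (Φ : ℕ → (Fin N → ℝ≥0) → ℝ≥0) : Prop :=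
  ∃ δ : ℝ≥0, 0 < δ ∧ ∀ k v, δ * ∑ i, v i ≤ Φ k v

/-- `Γ`-convergence of a sequence of reference functions: the `Γ`-liminf inequality along every
convergent sequence, and the existence of recovery sequences. -/
def GammaTendsto {N : ℕ} (Φk : ℕ → (Fin N → ℝ≥0) → ℝ≥0) (Φ : (Fin N → ℝ≥0) → ℝ≥0) : Prop :=
  (∀ (v : Fin N → ℝ≥0) (w : ℕ → Fin N → ℝ≥0), Tendsto w atTop (𝓝 v) →
      (Φ v : ℝ≥0∞) ≤ liminf (fun k => (Φk k (w k) : ℝ≥0∞)) atTop) ∧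
    ∀ v : Fin N → ℝ≥0, ∃ w : ℕ → Fin N → ℝ≥0, Tendsto w atTop (𝓝 v) ∧
      limsup (fun k => (Φk k (w k) : ℝ≥0∞)) atTop ≤ (Φ v : ℝ≥0∞)

/-! ### `BV₀` and `W₀^{1,p}` -/

/-- `u ∈ BV₀(F)`: `u ∈ BV(ℝᵈ)` and `u = 0` a.e. in `ℝᵈ \ F`. -/
structure MemBVZero {d : ℕ} (F : Set (EuclideanSpace ℝ (Fin d)))
    (u : EuclideanSpace ℝ (Fin d) → ℝ) : Prop where
  integrable : Integrable u
  totalVariation_lt_top : totalVariation u < ⊤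
  eq_zero : ∀ᵐ x, x ∉ F → u x = 0

/-- `g` is a weak gradient of `u` on `ℝᵈ` (both are required to be locally integrable). -/
structure IsWeakGradient {d : ℕ} (u : EuclideanSpace ℝ (Fin d) → ℝ)
    (g : EuclideanSpace ℝ (Fin d) → EuclideanSpace ℝ (Fin d)) : Prop where
  locallyIntegrable : LocallyIntegrable u
  locallyIntegrable_grad : LocallyIntegrable g
  integral_eq : ∀ η : EuclideanSpace ℝ (Fin d) → ℝ, ContDiff ℝ ∞ η → HasCompactSupport η →
    ∀ i, ∫ x, u x * fderiv ℝ η x (EuclideanSpace.single i 1) = -∫ x, g x i * η x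

/-- `u ∈ W₀^{1,p}(F)` with `∇u = g`: `u ∈ W^{1,p}(ℝᵈ)`, i.e. `u` and its weak gradient `g` are
in `Lᵖ(ℝᵈ)`, and `u = 0` a.e. on `ℝᵈ \ F`. -/
structure MemSobolevZero {d : ℕ} (p : ℝ) (F : Set (EuclideanSpace ℝ (Fin d)))
    (u : EuclideanSpace ℝ (Fin d) → ℝ)
    (g : EuclideanSpace ℝ (Fin d) → EuclideanSpace ℝ (Fin d)) : Prop where
  memLp : MemLp u (ENNReal.ofReal p)
  memLp_grad : MemLp g (ENNReal.ofReal p)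
  isWeakGradient : IsWeakGradient u g
  eq_zero : ∀ᵐ x, x ∉ F → u x = 0

/-- The first `p`-eigenvalue `λ_{1,p}(F)`, `p > 1`: the infimum of `∫_F |∇u|ᵖ` over the functions
`u ∈ W₀^{1,p}(F)` with `‖u‖_{Lᵖ} = 1`. -/
noncomputable def firstEigenvalue {d : ℕ} (p : ℝ) (F : Set (EuclideanSpace ℝ (Fin d))) : ℝ≥0∞ :=
  ⨅ w : {w : (EuclideanSpace ℝ (Fin d) → ℝ) ×
        (EuclideanSpace ℝ (Fin d) → EuclideanSpace ℝ (Fin d)) //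
      MemSobolevZero p F w.1 w.2 ∧ eLpNorm w.1 (ENNReal.ofReal p) volume = 1},
    ∫⁻ x in F, ‖w.1.2 x‖ₑ ^ p

/-- The constraints shared by all `(p,N)`-functions of `F`, `p ≥ 1`. -/
structure IsNormalizedDisjoint {d N : ℕ} (p : ℝ) (F : Set (EuclideanSpace ℝ (Fin d)))
    (u : Fin N → EuclideanSpace ℝ (Fin d) → ℝ) : Prop where
  nonneg : ∀ i, ∀ᵐ x, 0 ≤ u i x
  norm_eq_one : ∀ i, eLpNorm (u i) (ENNReal.ofReal p) volume = 1
  mul_eq_zero : ∀ i j, i ≠ j → ∀ᵐ x, x ∈ F → u i x * u j x = 0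

/-- `(1,N)`-functions of `F`. -/
structure IsOneNFunction {d N : ℕ} (F : Set (EuclideanSpace ℝ (Fin d)))
    (u : Fin N → EuclideanSpace ℝ (Fin d) → ℝ) : Prop extends IsNormalizedDisjoint 1 F u where
  mem : ∀ i, MemBVZero F (u i)

/-- `(p,N)`-functions of `F`, `p > 1`, with gradients `∇uᵢ = gᵢ`. -/
structure IsPNFunction {d N : ℕ} (p : ℝ) (F : Set (EuclideanSpace ℝ (Fin d)))
    (u : Fin N → EuclideanSpace ℝ (Fin d) → ℝ)
    (g : Fin N → EuclideanSpace ℝ (Fin d) → EuclideanSpace ℝ (Fin d)) : Prop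
    extends IsNormalizedDisjoint p F u where
  mem : ∀ i, MemSobolevZero p F (u i) (g i)

/-! ### The three constants -/

/-- The `(Φ,N)`-Cheeger constant `H^{Φ,N}(F)`. -/
noncomputable def cheegerN {d N : ℕ} (Φ : (Fin N → ℝ≥0) → ℝ≥0)
    (F : Set (EuclideanSpace ℝ (Fin d))) : ℝ≥0∞ :=
  ⨅ E : {E : Fin N → Set (EuclideanSpace ℝ (Fin d)) // IsNCluster F E},
    evalExt Φ fun i => perimeter (E.1 i) / volume (E.1 i)

/-- The first `p`-functional `(Φ,N)`-eigenvalue `Λ^{Φ,N}_{1,p}(F)`, `p ∈ [1,∞)`: the competitors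
are `BV₀` functions for `p = 1`, and `W₀^{1,p}` functions for `p > 1`. -/
noncomputable def functionalEigenvalue {d N : ℕ} (Φ : (Fin N → ℝ≥0) → ℝ≥0) (p : ℝ)
    (F : Set (EuclideanSpace ℝ (Fin d))) : ℝ≥0∞ :=
  open Classical in
  if p = 1 then
    ⨅ u : {u : Fin N → EuclideanSpace ℝ (Fin d) → ℝ // IsOneNFunction F u},
      evalExt Φ fun i => totalVariation (u.1 i)
  else
    ⨅ w : {w : (Fin N → EuclideanSpace ℝ (Fin d) → ℝ) ×
          (Fin N → EuclideanSpace ℝ (Fin d) → EuclideanSpace ℝ (Fin d)) //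
        IsPNFunction p F w.1 w.2},
      evalExt Φ fun i => ∫⁻ x, ‖w.1.2 i x‖ₑ ^ p

/-- The first `p`-geometric `(Φ,N)`-eigenvalue `𝓛^{Φ,N}_{1,p}(F)`, `p ∈ [1,∞)`: `Φ` is evaluated
at the Cheeger constants of the chambers for `p = 1`, and at their first `p`-eigenvalues for
`p > 1`. -/
noncomputable def geometricEigenvalue {d N : ℕ} (Φ : (Fin N → ℝ≥0) → ℝ≥0) (p : ℝ)
    (F : Set (EuclideanSpace ℝ (Fin d))) : ℝ≥0∞ :=
  open Classical in
  if p = 1 then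
    ⨅ E : {E : Fin N → Set (EuclideanSpace ℝ (Fin d)) // IsNSet F E},
      evalExt Φ fun i => cheegerConstant (E.1 i)
  else
    ⨅ E : {E : Fin N → Set (EuclideanSpace ℝ (Fin d)) // IsNSet F E},
      evalExt Φ fun i => firstEigenvalue p (E.1 i)

end NCheeger

/-! ### Reference functions on extended vectors, and stability of infima -/

namespace NCheeger

/-! All five constants are infima of `evalExt Φ (val x)` over a class of competitors `x` that does
not depend on `Φ`, so one abstract statement, `tendsto_iInf_evalExt`, gives every limit. The limsup
inequality is immediate: fix a competitor and use pointwise convergence. For the liminf inequality,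
take competitors with energy below a constant along a subsequence. Equicoercivity bounds their
vectors, which therefore subconverge to some `v`, and the `Γ`-liminf inequality bounds `Φ v`. Since
`Φ` is increasing, it remains to find a competitor whose vector is at most `v` componentwise.

That closedness property comes from compactness. Functions of bounded variation and Sobolev
functions are Lipschitz under translations in `Lᵖ`, so normalised sequences supported in the bounded
set `Ω` converge strongly and a.e. by Kolmogorov–Riesz. Strong convergence keeps the normalisation,
a.e. convergence keeps sign and disjointness, and the energies are lower semicontinuous: by duality
for the total variation, by weak compactness of the gradients for `p > 1`.

Sets are handled through functions. For clusters one uses the indicators divided by the volumes: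
their total variation is the Cheeger ratio, and their normalisation prevents chambers from vanishing
in the limit. For the geometric constants one takes almost optimal subsets or functions inside the
chambers; the sets where the limits are nonzero form the new `N`-set. The eigenvalue case also needs
that a Sobolev gradient vanishes a.e. on the zero set (`IsWeakGradient.ae_eq_zero`). -/

lemma evalExt_of_ne_top {N : ℕ} (Φ : (Fin N → ℝ≥0) → ℝ≥0) {v : Fin N → ℝ≥0∞}
    (hv : ∀ i, v i ≠ ⊤) : evalExt Φ v = (Φ fun i => (v i).toNNReal : ℝ≥0∞) := by
  classical
  simp only [evalExt]
  rw [if_pos hv]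

lemma ne_top_of_evalExt_lt_top {N : ℕ} {Φ : (Fin N → ℝ≥0) → ℝ≥0} {v : Fin N → ℝ≥0∞}
    (h : evalExt Φ v < ⊤) : ∀ i, v i ≠ ⊤ := by
  classical
  by_contra hv
  simp only [evalExt] at h
  rw [if_neg hv] at h
  exact lt_irrefl _ h

lemma evalExt_le_of_le {N : ℕ} {Φ : (Fin N → ℝ≥0) → ℝ≥0} (hΦ : Monotone Φ)
    {v : Fin N → ℝ≥0∞} {w : Fin N → ℝ≥0} (h : ∀ i, v i ≤ w i) : evalExt Φ v ≤ Φ w := by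
  rw [evalExt_of_ne_top Φ fun i => ne_top_of_le_ne_top ENNReal.coe_ne_top (h i)]
  exact_mod_cast hΦ fun i => ENNReal.toNNReal_mono ENNReal.coe_ne_top (h i)

lemma tendsto_evalExt {N : ℕ} {Φk : ℕ → (Fin N → ℝ≥0) → ℝ≥0} {Φ : (Fin N → ℝ≥0) → ℝ≥0}
    (h : ∀ v, Tendsto (fun k => Φk k v) atTop (𝓝 (Φ v))) (v : Fin N → ℝ≥0∞) :
    Tendsto (fun k => evalExt (Φk k) v) atTop (𝓝 (evalExt Φ v)) := by
  classical
  by_cases hv : ∀ i, v i ≠ ⊤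
  · simp only [evalExt_of_ne_top _ hv]
    exact ENNReal.tendsto_coe.2 (h _)
  · simp only [evalExt, if_neg hv]
    exact tendsto_const_nhds

/-- The `Γ`-liminf inequality along a subsequence of indices. -/
lemma GammaTendsto.le_of_frequently {N : ℕ} {Φk : ℕ → (Fin N → ℝ≥0) → ℝ≥0}
    {Φ : (Fin N → ℝ≥0) → ℝ≥0} (h : GammaTendsto Φk Φ) {n : ℕ → ℕ} (hn : StrictMono n)
    {w : ℕ → Fin N → ℝ≥0} {v : Fin N → ℝ≥0} (hw : Tendsto w atTop (𝓝 v)) {c : ℝ≥0∞}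
    (hc : ∀ j, (Φk (n j) (w j) : ℝ≥0∞) ≤ c) : (Φ v : ℝ≥0∞) ≤ c := by
  -- The `Γ`-liminf inequality speaks of full sequences, so the indices missed by `n` are filled
  -- with the limit `v` itself, which preserves convergence.
  have hext : Tendsto (Function.extend n w fun _ => v) atTop (𝓝 v) := by
    rw [tendsto_nhds] at hw ⊢
    intro s hs hv
    obtain ⟨J, hJ⟩ := mem_atTop_sets.1 (hw s hs hv)
    refine mem_atTop_sets.2 ⟨n J, fun m hm => ?_⟩
    by_cases hmn : ∃ j, n j = m
    · obtain ⟨j, rfl⟩ := hmn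
      rw [Set.mem_preimage, hn.injective.extend_apply]
      exact hJ j (hn.le_iff_le.1 hm)
    · rw [Set.mem_preimage, Function.extend_apply' _ _ _ hmn]
      exact hv
  refine (h.1 v _ hext).trans (liminf_le_of_frequently_le' ?_)
  refine hn.tendsto_atTop.frequently (Frequently.of_forall fun j => ?_)
  rw [hn.injective.extend_apply]
  exact hc j

/-- Stability of infima over a class of competitors that is closed, up to decreasing the
components, under limits of the vectors `val x`. -/
theorem tendsto_iInf_evalExt {N : ℕ} {ι : Type*} (val : ι → Fin N → ℝ≥0∞)
    {Φk : ℕ → (Fin N → ℝ≥0) → ℝ≥0} {Φ : (Fin N → ℝ≥0) → ℝ≥0}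
    (h_equi : Equicoercive Φk) (h_ptw : ∀ v, Tendsto (fun k => Φk k v) atTop (𝓝 (Φ v)))
    (h_gamma : GammaTendsto Φk Φ) (h_incr : Monotone Φ)
    (hval : ∀ (x : ℕ → ι) (v : Fin N → ℝ≥0), (∀ n i, val (x n) i ≠ ⊤) →
      (∀ i, Tendsto (fun n => val (x n) i) atTop (𝓝 (v i : ℝ≥0∞))) →
      ∃ y, ∀ i, val y i ≤ v i) :
    Tendsto (fun k => ⨅ x, evalExt (Φk k) (val x)) atTop (𝓝 (⨅ x, evalExt Φ (val x))) := by
  refine tendsto_of_le_liminf_of_limsup_le ?_ ?_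
  · by_contra! hlt
    obtain ⟨c, hc1, hc2⟩ := exists_between hlt
    obtain ⟨n, hn, hnc⟩ := extraction_of_frequently_atTop (frequently_lt_of_liminf_lt (by isBoundedDefault) hc1)
    have hctop : c ≠ ⊤ := hc2.ne_top
    choose x hx using fun j => iInf_lt_iff.1 (hnc j)
    have hfin : ∀ j i, val (x j) i ≠ ⊤ := fun j =>
      ne_top_of_evalExt_lt_top ((hx j).trans hctop.lt_top)
    set w : ℕ → Fin N → ℝ≥0 := fun j i => (val (x j) i).toNNReal with hw
    have hxw : ∀ j, (Φk (n j) (w j) : ℝ≥0∞) < c := fun j => by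
      have := hx j
      rwa [evalExt_of_ne_top _ (hfin j)] at this
    obtain ⟨δ, hδ, hcoer⟩ := h_equi
    lift c to ℝ≥0 using hctop
    -- Equicoercivity: `δ ‖w j‖₁ ≤ c` confines all these vectors to one compact box.
    have hbdd : ∀ j, w j ∈ Set.Icc (0 : Fin N → ℝ≥0) fun _ => c / δ := by
      refine fun j => ⟨fun i => zero_le, fun i => ?_⟩
      rw [le_div_iff₀ hδ, mul_comm]
      calc δ * w j i ≤ δ * ∑ i, w j i := by
            gcongr
            exact Finset.single_le_sum (fun _ _ => zero_le) (Finset.mem_univ i)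
        _ ≤ Φk (n j) (w j) := hcoer _ _
        _ ≤ c := by exact_mod_cast (hxw j).le
    have hcpt : IsCompact (Set.Icc (0 : Fin N → ℝ≥0) fun _ => c / δ) := isCompact_Icc
    obtain ⟨v, -, φ, hφ, hlim⟩ := hcpt.tendsto_subseq hbdd
    obtain ⟨y, hy⟩ := hval (x ∘ φ) v (fun j => hfin _) fun i => by
      have h1 : Tendsto (fun j => ((w (φ j) i : ℝ≥0) : ℝ≥0∞)) atTop (𝓝 (v i)) :=
        ENNReal.tendsto_coe.2 ((tendsto_pi_nhds.1 hlim) i)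
      refine h1.congr fun j => ?_
      exact ENNReal.coe_toNNReal (hfin _ _)
    have h2 : (Φ v : ℝ≥0∞) ≤ c :=
      h_gamma.le_of_frequently (hn.comp hφ) hlim fun j => (hxw (φ j)).le
    exact absurd (hc2.trans_le ((iInf_le _ y).trans ((evalExt_le_of_le h_incr hy).trans h2)))
      (lt_irrefl _)
  -- Each fixed competitor bounds the `k`-th infimum, and its energy converges pointwise.
  · refine le_iInf fun x => ?_
    rw [← (tendsto_evalExt h_ptw (val x)).limsup_eq]
    exact limsup_le_limsup (Eventually.of_forall fun k => iInf_le _ x)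

/-! ### The `L¹` norm by duality, and translated pairings -/

section Duality

variable {V : Type*} [NormedAddCommGroup V] [InnerProductSpace ℝ V] [FiniteDimensional ℝ V]
  [MeasurableSpace V] [BorelSpace V] {μ : Measure V} [μ.IsAddHaarMeasure]

/-- The `L¹` norm is controlled by the pairings with smooth compactly supported functions. -/
lemma integral_abs_le_of_forall_integral_mul_le {w : V → ℝ} (hw : Integrable w μ) {C : ℝ}
    (h : ∀ η : V → ℝ, ContDiff ℝ ∞ η → HasCompactSupport η → (∀ x, |η x| ≤ 1) →
      ∫ x, w x * η x ∂μ ≤ C) : ∫ x, |w x| ∂μ ≤ C := by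
  -- The natural test function is the sign of `w`. It is cut off to a ball to have compact support,
  -- then mollified.
  have key : ∀ R : ℕ, ∫ x in Metric.closedBall (0 : V) R, |w x| ∂μ ≤ C := by
    intro R
    set w' := hw.1.mk w with hw'
    have hww' : w =ᵐ[μ] w' := hw.1.ae_eq_mk
    have hw'm : Measurable w' := hw.1.stronglyMeasurable_mk.measurable
    set s : V → ℝ := (Metric.closedBall (0 : V) R).indicator
      fun x => if 0 ≤ w' x then (1 : ℝ) else -1 with hs
    have hsm : Measurable s :=
      (Measurable.ite (measurableSet_le measurable_const hw'm) measurable_const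
        measurable_const).indicator Metric.isClosed_closedBall.measurableSet
    have hs1 : ∀ x, ‖s x‖ ≤ 1 := by
      intro x
      simp only [hs, Set.indicator]
      split_ifs <;> simp
    have hsc : HasCompactSupport s :=
      HasCompactSupport.intro (isCompact_closedBall 0 (R : ℝ)) fun x hx => by
        simp [hs, hx]
    have hsi : Integrable s μ := by
      refine Measure.integrableOn_of_bounded (s := Metric.closedBall (0 : V) R) (M := 1)
        measure_closedBall_lt_top.ne hsm.aestronglyMeasurable (ae_of_all _ hs1) |>.integrable_of_forall_notMem_eq_zero fun x hx => ?_
      simp [hs, hx]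
    -- The outer radius is twice the inner one: this is the ratio bound `K = 2` needed for a.e.
    -- convergence of the mollifications.
    let φ : ℕ → ContDiffBump (0 : V) := fun n =>
      ⟨1 / (n + 1), 2 / (n + 1), by positivity, by gcongr; norm_num⟩
    have hφ : Tendsto (fun n => (φ n).rOut) atTop (𝓝 0) := by
      have := (tendsto_one_div_add_atTop_nhds_zero_nat (𝕜 := ℝ)).const_mul 2
      simpa [φ, div_eq_mul_inv] using this
    set η : ℕ → V → ℝ := fun n =>
      MeasureTheory.convolution ((φ n).normed μ) s (ContinuousLinearMap.lsmul ℝ ℝ) μ with hη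
    have hηlim : ∀ᵐ x ∂μ, Tendsto (fun n => η n x) atTop (𝓝 (s x)) :=
      ContDiffBump.ae_convolution_tendsto_right_of_locallyIntegrable hφ (K := 2)
        (Eventually.of_forall fun n => by simp only [φ]; exact le_of_eq (by ring))
        hsi.locallyIntegrable
    have hηc : ∀ n, ContDiff ℝ ∞ (η n) := fun n =>
      (φ n).hasCompactSupport_normed.contDiff_convolution_left _ (φ n).contDiff_normed
        hsi.locallyIntegrable
    have hηs : ∀ n, HasCompactSupport (η n) := fun n =>
      (φ n).hasCompactSupport_normed.convolution _ hsc
    have hη1 : ∀ n x, |η n x| ≤ 1 := by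
      intro n x
      rw [hη, ← Real.norm_eq_abs]
      calc ‖MeasureTheory.convolution ((φ n).normed μ) s (ContinuousLinearMap.lsmul ℝ ℝ) μ x‖
          ≤ ∫ t, (φ n).normed μ t ∂μ := by
            refine norm_integral_le_of_norm_le (φ n).integrable_normed (ae_of_all _ fun t => ?_)
            rw [ContinuousLinearMap.lsmul_apply, norm_smul,
              Real.norm_of_nonneg ((φ n).nonneg_normed t)]
            exact mul_le_of_le_one_right ((φ n).nonneg_normed t) (hs1 _)
        _ = 1 := (φ n).integral_normed
    have hlim : Tendsto (fun n => ∫ x, w x * η n x ∂μ) atTop (𝓝 (∫ x, w x * s x ∂μ)) := by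
      refine tendsto_integral_of_dominated_convergence (fun x => ‖w x‖)
        (fun n => hw.1.mul (hηc n).continuous.aestronglyMeasurable) hw.norm
        (fun n => ae_of_all _ fun x => ?_) ?_
      · rw [norm_mul]
        exact mul_le_of_le_one_right (norm_nonneg _) (hη1 n x)
      · filter_upwards [hηlim] with x hx using hx.const_mul _
    have heq : ∫ x in Metric.closedBall (0 : V) R, |w x| ∂μ = ∫ x, w x * s x ∂μ := by
      rw [← integral_indicator Metric.isClosed_closedBall.measurableSet]
      refine integral_congr_ae ?_
      filter_upwards [hww'] with x hx
      by_cases hxR : x ∈ Metric.closedBall (0 : V) R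
      · simp only [hs, Set.indicator_of_mem hxR, hx]
        split_ifs with h0
        · rw [abs_of_nonneg h0, mul_one]
        · rw [abs_of_neg (not_le.1 h0)]; ring
      · simp only [hs, Set.indicator_of_notMem hxR, mul_zero]
    rw [heq]
    exact le_of_tendsto' hlim fun n => h _ (hηc n) (hηs n) (hη1 n)
  have hcov : AECover μ atTop fun R : ℕ => Metric.closedBall (0 : V) R :=
    aecover_closedBall tendsto_natCast_atTop_atTop
  exact le_of_tendsto' (hcov.integral_tendsto_of_countably_generated hw.abs) key

end Duality

/-- Differentiation of `t ↦ ∫ u(x) η(x - t h) dx`. -/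
lemma hasDerivAt_integral_mul_comp_sub {V : Type*} [NormedAddCommGroup V] [InnerProductSpace ℝ V]
    [MeasurableSpace V] [BorelSpace V] {μ : Measure V} {u η : V → ℝ} (hu : Integrable u μ) (hη : ContDiff ℝ 1 η)
    (hηs : HasCompactSupport η) (h : V) (t : ℝ) :
    HasDerivAt (fun t : ℝ => ∫ x, u x * η (x - t • h) ∂μ)
      (-∫ x, u x * fderiv ℝ η (x - t • h) h ∂μ) t := by
  have hcont : Continuous fun x => fderiv ℝ η x h :=
    (hη.continuous_fderiv one_ne_zero).clm_apply continuous_const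
  have hsupp : HasCompactSupport fun x => fderiv ℝ η x h := hηs.fderiv_apply (𝕜 := ℝ) h
  obtain ⟨C, hC⟩ := hsupp.exists_bound_of_continuous hcont
  obtain ⟨C', hC'⟩ := hηs.exists_bound_of_continuous hη.continuous
  rw [← integral_neg]
  refine (hasDerivAt_integral_of_dominated_loc_of_deriv_le (s := Set.univ)
    (F' := fun t x => -(u x * fderiv ℝ η (x - t • h) h)) (bound := fun x => ‖u x‖ * C)
    univ_mem (Eventually.of_forall fun t => ?_) ?_ ?_ ?_ ?_ ?_).2
  · exact hu.1.mul (hη.continuous.comp (by fun_prop)).aestronglyMeasurable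
  · refine hu.mul_bdd (c := C') ?_ (ae_of_all _ fun x => hC' _)
    exact (hη.continuous.comp (by fun_prop)).aestronglyMeasurable
  · exact (hu.1.mul (hcont.comp (by fun_prop)).aestronglyMeasurable).neg
  · refine ae_of_all _ fun x s _ => ?_
    rw [norm_neg, norm_mul]
    gcongr
    exact hC _
  · exact hu.norm.mul_const C
  · refine ae_of_all _ fun x s _ => ?_
    have h1 : HasDerivAt (fun s : ℝ => x - s • h) (-h) s := by
      simpa using ((hasDerivAt_id s).smul_const h).const_sub x
    have h2 := ((hη.differentiable one_ne_zero).differentiableAt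
      (x := x - s • h)).hasFDerivAt.comp_hasDerivAt s h1
    simpa [Function.comp_def, mul_neg] using h2.const_mul (u x)

/-! ### Translations of functions of bounded variation -/

section BV

variable {d : ℕ}

lemma integral_mul_divergence_le {u : EuclideanSpace ℝ (Fin d) → ℝ} (hu : totalVariation u ≠ ⊤)
    {φ : EuclideanSpace ℝ (Fin d) → EuclideanSpace ℝ (Fin d)} (hφ : ContDiff ℝ 1 φ)
    (hφs : HasCompactSupport φ) (hφ1 : ∀ x, ‖φ x‖ ≤ 1) :
    ∫ x, u x * divergence φ x ≤ (totalVariation u).toReal := by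
  refine (ENNReal.ofReal_le_iff_le_toReal hu).1 ?_
  exact le_iSup (fun φ : {φ : EuclideanSpace ℝ (Fin d) → EuclideanSpace ℝ (Fin d) //
      ContDiff ℝ 1 φ ∧ HasCompactSupport φ ∧ ∀ x, ‖φ x‖ ≤ 1} =>
    ENNReal.ofReal (∫ x, u x * divergence φ.1 x)) ⟨φ, hφ, hφs, hφ1⟩

lemma divergence_smul_const {η : EuclideanSpace ℝ (Fin d) → ℝ} (hη : ContDiff ℝ 1 η)
    (h x : EuclideanSpace ℝ (Fin d)) :
    divergence (fun x => η x • h) x = fderiv ℝ η x h := by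
  have h1 : fderiv ℝ (fun x => η x • h) x = (fderiv ℝ η x).smulRight h :=
    fderiv_smul_const ((hη.differentiable one_ne_zero) x) h
  simp only [divergence, h1, ContinuousLinearMap.smulRight_apply, PiLp.smul_apply, smul_eq_mul]
  conv_rhs => rw [← (EuclideanSpace.basisFun (Fin d) ℝ).sum_repr h]
  simp [mul_comm]

/-- A field `η e` with constant direction has divergence `∂ₑη`, so it suffices to test the total
variation with `e = ±h / ‖h‖`. -/
lemma abs_integral_mul_fderiv_le {u η : EuclideanSpace ℝ (Fin d) → ℝ}
    (hu : totalVariation u ≠ ⊤) (hη : ContDiff ℝ 1 η) (hηs : HasCompactSupport η)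
    (hη1 : ∀ x, |η x| ≤ 1) (h : EuclideanSpace ℝ (Fin d)) :
    |∫ x, u x * fderiv ℝ η x h| ≤ (totalVariation u).toReal * ‖h‖ := by
  rcases eq_or_ne h 0 with rfl | hh
  · simp
  have hh' : 0 < ‖h‖ := norm_pos_iff.2 hh
  have key : ∀ e : EuclideanSpace ℝ (Fin d), ‖e‖ ≤ 1 →
      ∫ x, u x * fderiv ℝ η x e ≤ (totalVariation u).toReal := by
    intro e he
    have := integral_mul_divergence_le hu (φ := fun x => η x • e) (hη.smul contDiff_const)
      hηs.smul_right fun x => by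
        rw [norm_smul]
        exact mul_le_one₀ (hη1 x) (norm_nonneg _) he
    simpa only [divergence_smul_const hη] using this
  have h1 := key (‖h‖⁻¹ • h) (by rw [norm_smul, norm_inv, norm_norm, inv_mul_cancel₀ hh'.ne'])
  have h2 := key (-(‖h‖⁻¹ • h))
    (by rw [norm_neg, norm_smul, norm_inv, norm_norm, inv_mul_cancel₀ hh'.ne'])
  simp only [map_neg, map_smul, smul_eq_mul, mul_neg, integral_neg,
    mul_left_comm _ (‖h‖⁻¹) _, integral_const_mul] at h1 h2
  rw [inv_mul_le_iff₀ hh'] at h1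
  rw [← mul_neg, inv_mul_le_iff₀ hh'] at h2
  rw [mul_comm]
  exact abs_le.2 ⟨by linarith, h1⟩

/-- Translation invariance moves the increment from `u`, which is not regular, onto the test
function, where it can be differentiated. -/
lemma integral_comp_add_sub_mul {V : Type*} [NormedAddCommGroup V] [InnerProductSpace ℝ V]
    [MeasurableSpace V] [BorelSpace V] {μ : Measure V} [μ.IsAddRightInvariant]
    {u η : V → ℝ} (hu : Integrable u μ) (hη : Continuous η) (hηs : HasCompactSupport η) (h : V) :
    ∫ x, (u (x + h) - u x) * η x ∂μ = (∫ x, u x * η (x - h) ∂μ) - ∫ x, u x * η x ∂μ := by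
  obtain ⟨C, hC⟩ := hηs.exists_bound_of_continuous hη
  have h1 : Integrable (fun x => u (x + h) * η x) μ :=
    (hu.comp_add_right h).mul_bdd (c := C) hη.aestronglyMeasurable (ae_of_all _ hC)
  have h2 : Integrable (fun x => u x * η x) μ :=
    hu.mul_bdd (c := C) hη.aestronglyMeasurable (ae_of_all _ hC)
  simp only [sub_mul]
  rw [integral_sub h1 h2]
  congr 1
  rw [← integral_add_right_eq_self (fun x => u x * η (x - h)) h]
  simp

/-- Translations are Lipschitz in `L¹` for functions of bounded variation. -/
theorem eLpNorm_translate_sub_le_totalVariation {u : EuclideanSpace ℝ (Fin d) → ℝ}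
    (hui : Integrable u) (hu : totalVariation u ≠ ⊤) (h : EuclideanSpace ℝ (Fin d)) :
    eLpNorm (fun x => u (x + h) - u x) 1 volume ≤
      ENNReal.ofReal ((totalVariation u).toReal * ‖h‖) := by
  have hint : Integrable fun x => u (x + h) - u x := (hui.comp_add_right h).sub hui
  rw [eLpNorm_one_eq_lintegral_enorm, ← ofReal_integral_norm_eq_lintegral_enorm hint]
  refine ENNReal.ofReal_le_ofReal ?_
  refine integral_abs_le_of_forall_integral_mul_le hint fun η hη hηs hη1 => ?_
  have hη' : ContDiff ℝ 1 η := hη.of_le (by exact_mod_cast le_top)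
  rw [integral_comp_add_sub_mul hui hη.continuous hηs]
  -- Mean value inequality on `[0, 1]` for the pairing of `u` with the translates of `η`.
  -- Translating `η` keeps it admissible, so the derivative bound is uniform in `t`.
  have hmv := norm_image_sub_le_of_norm_deriv_le_segment_01'
    (f := fun t : ℝ => ∫ x, u x * η (x - t • h))
    (fun t _ => (hasDerivAt_integral_mul_comp_sub hui hη' hηs h t).hasDerivWithinAt)
    (C := (totalVariation u).toReal * ‖h‖) fun t _ => by
      rw [norm_neg, Real.norm_eq_abs]
      have := abs_integral_mul_fderiv_le hu (η := fun x => η (x - t • h))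
        (hη'.comp (contDiff_id.sub contDiff_const))
        (hηs.comp_homeomorph (Homeomorph.subRight (t • h))) (fun x => hη1 _) h
      simpa only [fderiv_comp_sub] using this
  simp only [one_smul, zero_smul, sub_zero] at hmv
  exact (le_abs_self _).trans hmv

end BV

/-! ### Averages of translates in `Lᵖ` -/

section Averages

variable {α β E : Type*} [MeasurableSpace α] [MeasurableSpace β] [NormedAddCommGroup E]
  {μ : Measure α} {ν : Measure β} {p : ℝ≥0∞}

lemma lintegral_eLpNorm_rpow_prod [SFinite ν] (hp0 : p ≠ 0) (hp : p ≠ ⊤)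
    {F : α × β → E} (hF : AEStronglyMeasurable F (μ.prod ν)) :
    ∫⁻ x, eLpNorm (fun y => F (x, y)) p ν ^ p.toReal ∂μ =
      eLpNorm F p (μ.prod ν) ^ p.toReal := by
  have hp' : p.toReal ≠ 0 := (ENNReal.toReal_pos hp0 hp).ne'
  simp only [eLpNorm_eq_lintegral_rpow_enorm_toReal hp0 hp, ← ENNReal.rpow_mul, one_div,
    inv_mul_cancel₀ hp', ENNReal.rpow_one]
  exact (lintegral_prod _ (hF.enorm.pow_const _)).symm

/-- By Tonelli the `p`-th power of the joint norm is the average over `y` of the `p`-th powers of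
the slice norms, because `ν` has mass one. -/
lemma eLpNorm_prod_le_of_forall [SFinite μ] [IsProbabilityMeasure ν] (hp0 : p ≠ 0) (hp : p ≠ ⊤)
    {F : α × β → E} (hF : AEStronglyMeasurable F (μ.prod ν)) {C : ℝ≥0∞}
    (hC : ∀ᵐ y ∂ν, eLpNorm (fun x => F (x, y)) p μ ≤ C) : eLpNorm F p (μ.prod ν) ≤ C := by
  have hp' : 0 < p.toReal := ENNReal.toReal_pos hp0 hp
  rw [← ENNReal.rpow_le_rpow_iff hp']
  have hsw := Measure.measurePreserving_swap (μ := ν) (ν := μ)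
  have hFs : AEStronglyMeasurable (F ∘ Prod.swap) (ν.prod μ) :=
    hF.comp_measurePreserving hsw
  rw [← eLpNorm_comp_measurePreserving hF hsw, ← lintegral_eLpNorm_rpow_prod hp0 hp hFs]
  calc ∫⁻ y, eLpNorm (fun x => (F ∘ Prod.swap) (y, x)) p μ ^ p.toReal ∂ν
      ≤ ∫⁻ _, C ^ p.toReal ∂ν := by
        refine lintegral_mono_ae ?_
        filter_upwards [hC] with y hy
        exact ENNReal.rpow_le_rpow hy hp'.le
    _ = C ^ p.toReal := by simp

lemma _root_.MeasureTheory.MemLp.ae_memLp_prod_right [SFinite ν] (hp0 : p ≠ 0) (hp : p ≠ ⊤)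
    {F : α × β → E} (hF : MemLp F p (μ.prod ν)) : ∀ᵐ x ∂μ, MemLp (fun y => F (x, y)) p ν := by
  have hp' : 0 < p.toReal := ENNReal.toReal_pos hp0 hp
  have hfin : ∫⁻ x, eLpNorm (fun y => F (x, y)) p ν ^ p.toReal ∂μ ≠ ⊤ := by
    rw [lintegral_eLpNorm_rpow_prod hp0 hp hF.1]
    exact ENNReal.rpow_ne_top_of_nonneg hp'.le hF.2.ne
  have hmeas : AEMeasurable (fun x => eLpNorm (fun y => F (x, y)) p ν ^ p.toReal) μ := by
    simp only [eLpNorm_eq_lintegral_rpow_enorm_toReal hp0 hp, ← ENNReal.rpow_mul, one_div,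
      inv_mul_cancel₀ hp'.ne', ENNReal.rpow_one]
    exact (hF.1.enorm.pow_const _).lintegral_prod_right'
  filter_upwards [ae_lt_top' hmeas hfin, hF.1.prodMk_left] with x hx hx'
  exact ⟨hx', (ENNReal.rpow_lt_top_iff_of_pos hp').1 hx⟩

/-- Jensen's inequality for averages of functions in `Lᵖ`. -/
lemma eLpNorm_integral_le_eLpNorm_prod [NormedSpace ℝ E] [IsProbabilityMeasure ν]
    (hp1 : 1 ≤ p) (hp : p ≠ ⊤) {F : α × β → E} (hF : AEStronglyMeasurable F (μ.prod ν)) :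
    eLpNorm (fun x => ∫ y, F (x, y) ∂ν) p μ ≤ eLpNorm F p (μ.prod ν) := by
  have hp0 : p ≠ 0 := (one_pos.trans_le hp1).ne'
  have hp' : 0 < p.toReal := ENNReal.toReal_pos hp0 hp
  rw [← ENNReal.rpow_le_rpow_iff hp', ← lintegral_eLpNorm_rpow_prod hp0 hp hF,
    eLpNorm_eq_lintegral_rpow_enorm_toReal hp0 hp, ← ENNReal.rpow_mul, one_div,
    inv_mul_cancel₀ hp'.ne', ENNReal.rpow_one]
  refine lintegral_mono_ae ?_
  filter_upwards [hF.prodMk_left] with x hx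
  refine ENNReal.rpow_le_rpow ?_ hp'.le
  calc ‖∫ y, F (x, y) ∂ν‖ₑ ≤ ∫⁻ y, ‖F (x, y)‖ₑ ∂ν := enorm_integral_le_lintegral_enorm _
    _ = eLpNorm (fun y => F (x, y)) 1 ν := eLpNorm_one_eq_lintegral_enorm.symm
    _ ≤ eLpNorm (fun y => F (x, y)) p ν := eLpNorm_le_eLpNorm_of_exponent_le hp1 hx

end Averages

section Translations

variable {V β E : Type*} [NormedAddCommGroup V] [MeasurableSpace V] [BorelSpace V]
  [SecondCountableTopology V]
  [MeasurableSpace β] [NormedAddCommGroup E] {μ : Measure V} [SFinite μ] [μ.IsAddRightInvariant]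
  {ν : Measure β} [IsProbabilityMeasure ν] {p : ℝ≥0∞}

/-- The shear `(y, x) ↦ (y, x + τ y)` preserves the product measure, being a translation on each
fibre; then project. Measurability and norms of `f (x + τ y)` on the product thus reduce to those of
`f`. -/
lemma measurePreserving_add_comp {τ : β → V} (hτ : Measurable τ) :
    MeasurePreserving (fun z : V × β => z.1 + τ z.2) (μ.prod ν) μ := by
  have h1 : MeasurePreserving (fun z : β × V => (z.1, z.2 + τ z.1)) (ν.prod μ) (ν.prod μ) :=
    (MeasurePreserving.id ν).skew_product (g := fun y x => x + τ y)
      (by fun_prop)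
      (ae_of_all _ fun y => (measurePreserving_add_right μ (τ y)).map_eq)
  exact (measurePreserving_snd (μ := ν) (ν := μ)).comp
    (h1.comp (Measure.measurePreserving_swap (μ := μ) (ν := ν)))

lemma ae_integrable_comp_add (hp1 : 1 ≤ p) (hp : p ≠ ⊤) {f : V → E} (hf : MemLp f p μ)
    {τ : β → V} (hτ : Measurable τ) : ∀ᵐ x ∂μ, Integrable (fun y => f (x + τ y)) ν := by
  have h := (hf.comp_measurePreserving (measurePreserving_add_comp (ν := ν) hτ)).ae_memLp_prod_right
    (one_pos.trans_le hp1).ne' hp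
  filter_upwards [h] with x hx using hx.integrable hp1

variable [NormedSpace ℝ E]

/-- An average of translates has a smaller `Lᵖ` norm. -/
lemma eLpNorm_integral_comp_add_le (hp1 : 1 ≤ p) (hp : p ≠ ⊤) {f : V → E}
    (hf : AEStronglyMeasurable f μ) {τ : β → V} (hτ : Measurable τ) :
    eLpNorm (fun x => ∫ y, f (x + τ y) ∂ν) p μ ≤ eLpNorm f p μ := by
  have hT := measurePreserving_add_comp (μ := μ) (ν := ν) hτ
  exact (eLpNorm_integral_le_eLpNorm_prod hp1 hp (hf.comp_measurePreserving hT)).trans_eq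
    (eLpNorm_comp_measurePreserving hf hT)

/-- The distance in `Lᵖ` from a function to an average of its translates. -/
lemma eLpNorm_integral_comp_add_sub_le [CompleteSpace E] (hp1 : 1 ≤ p) (hp : p ≠ ⊤) {f : V → E}
    (hf : MemLp f p μ) {τ : β → V} (hτ : Measurable τ) {C : ℝ≥0∞}
    (hC : ∀ᵐ y ∂ν, eLpNorm (fun x => f (x + τ y) - f x) p μ ≤ C) :
    eLpNorm (fun x => (∫ y, f (x + τ y) ∂ν) - f x) p μ ≤ C := by
  have hT := measurePreserving_add_comp (μ := μ) (ν := ν) hτ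
  have hF : AEStronglyMeasurable (fun z : V × β => f (z.1 + τ z.2) - f z.1) (μ.prod ν) :=
    (hf.1.comp_measurePreserving hT).sub hf.1.comp_fst
  have heq : (fun x => (∫ y, f (x + τ y) ∂ν) - f x) =ᵐ[μ]
      fun x => ∫ y, (f (x + τ y) - f x) ∂ν := by
    filter_upwards [ae_integrable_comp_add hp1 hp hf hτ (ν := ν)] with x hx
    rw [integral_sub hx (integrable_const _), integral_const, probReal_univ, one_smul]
  rw [eLpNorm_congr_ae heq]
  exact (eLpNorm_integral_le_eLpNorm_prod hp1 hp hF).trans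
    (eLpNorm_prod_le_of_forall (one_pos.trans_le hp1).ne' hp hF hC)

end Translations

/-- Continuity of translations in `Lᵖ`. -/
lemma tendsto_eLpNorm_translate_sub {V E : Type*} [NormedAddCommGroup V] [NormedSpace ℝ V]
    [FiniteDimensional ℝ V] [MeasurableSpace V] [BorelSpace V] [NormedAddCommGroup E]
    {μ : Measure V} [μ.IsAddHaarMeasure] {p : ℝ≥0∞} (hp1 : 1 ≤ p) (hp : p ≠ ⊤) {f : V → E}
    (hf : MemLp f p μ) :
    Tendsto (fun h => eLpNorm (fun x => f (x + h) - f x) p μ) (𝓝 0) (𝓝 0) := by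
  have : Fact (1 ≤ p) := ⟨hp1⟩
  let T : C(V, C(V, V)) := (ContinuousMap.mk fun z : V × V => z.2 + z.1).curry
  have hT : ∀ h, MeasurePreserving (T h) μ μ := fun h => measurePreserving_add_right μ h
  have hc : Continuous fun h => Lp.compMeasurePreserving (T h) (hT h) (hf.toLp f) :=
    continuous_const.compMeasurePreservingLp T.continuous hT hp
  have h1 : Tendsto (fun h => edist (Lp.compMeasurePreserving (T h) (hT h) (hf.toLp f))
      (Lp.compMeasurePreserving (T 0) (hT 0) (hf.toLp f))) (𝓝 0) (𝓝 0) := by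
    have := (hc.tendsto 0).edist (tendsto_const_nhds (x := Lp.compMeasurePreserving (T 0) (hT 0) (hf.toLp f)))
    simpa only [edist_self] using this
  refine h1.congr fun h => ?_
  rw [Lp.edist_def]
  refine eLpNorm_congr_ae ?_
  have h2 : ∀ h, Lp.compMeasurePreserving (T h) (hT h) (hf.toLp f) =ᵐ[μ] fun x => f (x + h) :=
    fun h => (Lp.coeFn_compMeasurePreserving _ (hT h)).trans
      ((hT h).quasiMeasurePreserving.ae_eq_comp hf.coeFn_toLp)
  filter_upwards [h2 h, h2 0] with x hx hx0
  rw [Pi.sub_apply, hx, hx0, add_zero]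

/-! ### Sobolev functions: translations, and gradients on the zero set -/

section Sobolev

variable {d : ℕ} {u : EuclideanSpace ℝ (Fin d) → ℝ}
  {g : EuclideanSpace ℝ (Fin d) → EuclideanSpace ℝ (Fin d)} {p : ℝ≥0∞}

lemma IsWeakGradient.integral_mul_fderiv_eq (hw : IsWeakGradient u g)
    {η : EuclideanSpace ℝ (Fin d) → ℝ} (hη : ContDiff ℝ ∞ η) (hηs : HasCompactSupport η)
    (h : EuclideanSpace ℝ (Fin d)) :
    ∫ x, u x * fderiv ℝ η x h = -∫ x, inner ℝ (g x) h * η x := by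
  have h1 : ∀ x, u x * fderiv ℝ η x h =
      ∑ i, h i * (u x * fderiv ℝ η x (EuclideanSpace.single i 1)) := by
    intro x
    conv_lhs => rw [← (EuclideanSpace.basisFun (Fin d) ℝ).sum_repr h]
    simp [Finset.mul_sum, mul_left_comm]
  have h2 : ∀ x, inner ℝ (g x) h * η x = ∑ i, h i * (g x i * η x) := by
    intro x
    simp [PiLp.inner_apply, Finset.sum_mul, mul_assoc]
  simp only [h1, h2]
  rw [integral_finsetSum, integral_finsetSum, ← Finset.sum_neg_distrib]
  · refine Finset.sum_congr rfl fun i _ => ?_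
    rw [integral_const_mul, integral_const_mul, hw.integral_eq η hη hηs i, mul_neg]
  · intro i _
    refine Integrable.const_mul ?_ _
    have hgi : LocallyIntegrable (fun x => g x i) := fun x => by
      obtain ⟨s, hs, hi⟩ := hw.locallyIntegrable_grad x
      exact ⟨s, hs, (EuclideanSpace.proj (𝕜 := ℝ) i).integrable_comp hi⟩
    exact hgi.integrable_smul_right_of_hasCompactSupport hη.continuous hηs
  · intro i _
    refine Integrable.const_mul ?_ _
    exact hw.locallyIntegrable.integrable_smul_right_of_hasCompactSupport
      ((hη.continuous_fderiv (by simp)).clm_apply continuous_const) (hηs.fderiv_apply (𝕜 := ℝ) _)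

/-- A Sobolev function is recovered from its gradient along segments. -/
theorem IsWeakGradient.ae_translate_sub_eq (hw : IsWeakGradient u g) (hp1 : 1 ≤ p) (hp : p ≠ ⊤)
    (hu : Integrable u) (hg : MemLp g p) (h : EuclideanSpace ℝ (Fin d)) :
    ∀ᵐ x, u (x + h) - u x =
      ∫ s, inner ℝ (g (x + s • h)) h ∂(volume.restrict (Set.Ioc (0 : ℝ) 1)) := by
  set ν : Measure ℝ := volume.restrict (Set.Ioc (0 : ℝ) 1) with hν
  have : IsProbabilityMeasure ν := ⟨by simp [hν]⟩
  set γ : EuclideanSpace ℝ (Fin d) → ℝ := fun x => inner ℝ (g x) h with hγ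
  have hγp : MemLp γ p := hg.inner_const h
  have hτ : Measurable fun s : ℝ => s • h := by fun_prop
  have hT := measurePreserving_add_comp (μ := (volume : Measure (EuclideanSpace ℝ (Fin d))))
    (ν := ν) hτ
  have hγT : MemLp (fun z : EuclideanSpace ℝ (Fin d) × ℝ => γ (z.1 + z.2 • h)) p
      ((volume : Measure (EuclideanSpace ℝ (Fin d))).prod ν) := hγp.comp_measurePreserving hT
  have hW : MemLp (fun x => ∫ s, γ (x + s • h) ∂ν) p :=
    ⟨hγT.1.integral_prod_right', (eLpNorm_integral_comp_add_le hp1 hp hγp.1 hτ).trans_lt hγp.2⟩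
  -- Both sides are locally integrable, so it is enough to compare them as distributions.
  refine ae_eq_of_integral_contDiff_smul_eq ((hu.comp_add_right h).sub hu).locallyIntegrable
    (hW.locallyIntegrable hp1) fun η hη hηs => ?_
  have hη' : ContDiff ℝ 1 η := hη.of_le (by exact_mod_cast le_top)
  simp only [smul_eq_mul, mul_comm (η _)]
  rw [integral_comp_add_sub_mul hu hη.continuous hηs]
  have hderiv := fun t : ℝ => hasDerivAt_integral_mul_comp_sub hu hη' hηs h t
  -- The derivative in `t` is, up to sign, again a translated pairing, now with `∂ₕη`. Its own
  -- differentiability gives the continuity required by the fundamental theorem of calculus.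
  have hη2 : ContDiff ℝ 1 fun x => fderiv ℝ η x h :=
    ((contDiff_infty.1 hη 2).fderiv_right (m := 1) (by norm_num)).clm_apply contDiff_const
  have hcont : Continuous fun t : ℝ => -∫ x, u x * fderiv ℝ η (x - t • h) h :=
    (continuous_iff_continuousAt.2 fun t =>
      (hasDerivAt_integral_mul_comp_sub hu hη2 (hηs.fderiv_apply (𝕜 := ℝ) h) h t).continuousAt).neg
  have hftc := intervalIntegral.integral_eq_sub_of_hasDerivAt (a := 0) (b := 1)
    (fun t _ => hderiv t) (hcont.intervalIntegrable 0 1)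
  simp only [one_smul, zero_smul, sub_zero] at hftc
  rw [← hftc, intervalIntegral.integral_of_le zero_le_one]
  have hshift : ∀ t : ℝ, -∫ x, u x * fderiv ℝ η (x - t • h) h =
      ∫ x, γ (x + t • h) * η x := by
    intro t
    have h1 := hw.integral_mul_fderiv_eq (η := fun x => η (x - t • h))
      (hη.comp (contDiff_id.sub contDiff_const))
      (hηs.comp_homeomorph (Homeomorph.subRight (t • h))) h
    simp only [fderiv_comp_sub] at h1
    rw [h1, neg_neg, ← integral_add_right_eq_self _ (t • h)]
    simp [hγ]
  simp only [hshift]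
  rw [integral_integral_swap]
  · simp only [integral_mul_const]
    rfl
  -- Fubini is justified by Hölder on the product: the translated `γ` is in `Lᵖ`, and `η` is in the
  -- conjugate space since `ν` is finite.
  · have := ENNReal.HolderConjugate.conjExponent hp1
    have hηq : MemLp (fun z : EuclideanSpace ℝ (Fin d) × ℝ => η z.1) p.conjExponent
        ((volume : Measure (EuclideanSpace ℝ (Fin d))).prod ν) :=
      (hη.continuous.memLp_of_hasCompactSupport hηs).comp_measurePreserving
        (measurePreserving_fst (μ := volume) (ν := ν))
    exact (hγT.integrable_mul hηq).swap

/-- Translations are Lipschitz in `Lᵖ` for Sobolev functions. -/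
theorem IsWeakGradient.eLpNorm_translate_sub_le (hw : IsWeakGradient u g) (hp1 : 1 ≤ p)
    (hp : p ≠ ⊤) (hu : Integrable u) (hg : MemLp g p) (h : EuclideanSpace ℝ (Fin d)) :
    eLpNorm (fun x => u (x + h) - u x) p volume ≤ ENNReal.ofReal ‖h‖ * eLpNorm g p volume := by
  set ν : Measure ℝ := volume.restrict (Set.Ioc (0 : ℝ) 1) with hν
  have : IsProbabilityMeasure ν := ⟨by simp [hν]⟩
  rw [eLpNorm_congr_ae (hw.ae_translate_sub_eq hp1 hp hu hg h)]
  refine (eLpNorm_integral_comp_add_le (f := fun x => inner ℝ (g x) h) (τ := fun s : ℝ => s • h)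
    hp1 hp (hg.inner_const h).1 (by fun_prop)).trans ?_
  refine eLpNorm_le_mul_eLpNorm_of_ae_le_mul (ae_of_all _ fun x => ?_) p
  rw [mul_comm]
  exact norm_inner_le_norm _ _

/-- The gradient of a Sobolev function vanishes a.e. on its zero set. -/
theorem IsWeakGradient.ae_eq_zero (hw : IsWeakGradient u g) (hp1 : 1 ≤ p) (hp : p ≠ ⊤)
    (hu : Integrable u) (hfin : volume {x | u x ≠ 0} ≠ ⊤) (hg : MemLp g p) :
    ∀ᵐ x, u x = 0 → g x = 0 := by
  set ν : Measure ℝ := volume.restrict (Set.Ioc (0 : ℝ) 1) with hν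
  have : IsProbabilityMeasure ν := ⟨by simp [hν]⟩
  suffices H : ∀ i, ∀ᵐ x, u x = 0 → g x i = 0 by
    filter_upwards [ae_all_iff.2 H] with x hx hx0
    ext i
    exact hx i hx0
  intro i
  set e : EuclideanSpace ℝ (Fin d) := EuclideanSpace.single i 1 with he
  have hγ : MemLp (fun x => g x i) p := by
    simpa [he, PiLp.inner_apply] using hg.inner_const (𝕜 := ℝ) e
  set t : ℕ → ℝ := fun n => 1 / ((n : ℝ) + 1) with ht
  have htpos : ∀ n, 0 < t n := fun n => by positivity
  have htlim : Tendsto t atTop (𝓝 0) := tendsto_one_div_add_atTop_nhds_zero_nat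
  have hte : Tendsto (fun n => t n • e) atTop (𝓝 0) := by
    simpa using htlim.smul_const e
  -- The difference quotient in direction `e` is the average of `g · i` over a segment of length `t
  -- n`; by continuity of translations it tends to `g · i` in `Lᵖ`.
  have hD : ∀ n, (fun x => (t n)⁻¹ * (u (x + t n • e) - u x)) =ᵐ[volume]
      fun x => ∫ s, g (x + (s * t n) • e) i ∂ν := by
    intro n
    filter_upwards [hw.ae_translate_sub_eq hp1 hp hu hg (t n • e)] with x hx
    rw [hx, ← integral_const_mul]
    refine integral_congr_ae (ae_of_all _ fun s => ?_)
    simp [he, PiLp.inner_apply, inner_smul_right, smul_smul, (htpos n).ne']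
  have hlim : Tendsto (fun n => eLpNorm ((fun x => (t n)⁻¹ * (u (x + t n • e) - u x)) -
      fun x => g x i) p volume) atTop (𝓝 0) := by
    rw [ENNReal.tendsto_nhds_zero]
    intro ε hε
    have h1 := ENNReal.tendsto_nhds_zero.1 (tendsto_eLpNorm_translate_sub hp1 hp hγ) ε hε
    obtain ⟨δ, hδ, hball⟩ := Metric.eventually_nhds_iff.1 h1
    filter_upwards [htlim.eventually (gt_mem_nhds hδ)] with n hn
    rw [eLpNorm_congr_ae ((hD n).sub EventuallyEq.rfl)]
    refine eLpNorm_integral_comp_add_sub_le (τ := fun s : ℝ => (s * t n) • e) hp1 hp hγ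
      (by fun_prop) ?_
    rw [hν]
    refine (ae_restrict_iff' measurableSet_Ioc).2 (ae_of_all _ fun s hs => hball ?_)
    rw [dist_zero_right, norm_smul, he, PiLp.norm_single, norm_one, mul_one,
      Real.norm_of_nonneg (mul_nonneg hs.1.le (htpos n).le)]
    exact (mul_le_of_le_one_left (htpos n).le hs.2).trans_lt hn
  have hum : ∀ h, AEStronglyMeasurable (fun x => u (x + h)) volume := fun h =>
    (hu.comp_add_right h).1
  obtain ⟨φ, hφ, hφlim⟩ := (tendstoInMeasure_of_tendsto_eLpNorm (one_pos.trans_le hp1).ne'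
    (fun n => ((hum _).sub hu.1).const_mul _) hγ.1 hlim).exists_seq_tendsto_ae
  set A : Set (EuclideanSpace ℝ (Fin d)) := {x | u x ≠ 0} with hA
  have hAm : NullMeasurableSet A :=
    (hu.1.aemeasurable.nullMeasurable (measurableSet_singleton 0)).compl
  have hAi : MemLp (A.indicator fun _ => (1 : ℝ)) 1 volume :=
    memLp_one_iff_integrable.2 ((integrableOn_const hfin).integrable_indicator₀ hAm)
  -- Finite measure of `A` puts its indicator in `L¹`. Along a subsequence, a.e. point outside `A`
  -- then has its translates eventually outside `A`: there the difference quotients are zero, and so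
  -- is their limit `g x i`.
  have hAlim : Tendsto (fun k => eLpNorm ((fun x => A.indicator (fun _ => (1 : ℝ))
      (x + t (φ k) • e)) - A.indicator fun _ => (1 : ℝ)) 1 volume) atTop (𝓝 0) :=
    (tendsto_eLpNorm_translate_sub le_rfl ENNReal.one_ne_top hAi).comp
      (hte.comp hφ.tendsto_atTop)
  obtain ⟨ψ, hψ, hψlim⟩ := (tendstoInMeasure_of_tendsto_eLpNorm one_ne_zero
    (fun k => ((memLp_one_iff_integrable.1 hAi).comp_add_right _).1) hAi.1
    hAlim).exists_seq_tendsto_ae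
  filter_upwards [hφlim, hψlim] with x hx1 hx2 hx0
  have hxA : A.indicator (fun _ => (1 : ℝ)) x = 0 := by simp [hA, hx0]
  rw [hxA] at hx2
  refine tendsto_nhds_unique (hx1.comp hψ.tendsto_atTop) (tendsto_const_nhds.congr' ?_)
  filter_upwards [hx2.eventually (gt_mem_nhds one_pos)] with k hk
  have : u (x + t (φ (ψ k)) • e) = 0 := by
    by_contra hne
    rw [Set.indicator_of_mem (show _ ∈ A from hne)] at hk
    exact lt_irrefl _ hk
  simp [this, hx0]

end Sobolev

/-! ### Kolmogorov–Riesz compactness -/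

section Compactness

variable {V : Type*} [NormedAddCommGroup V] [MeasurableSpace V] [BorelSpace V] {μ : Measure V}
  [μ.IsAddHaarMeasure] {p : ℝ≥0∞}

lemma memLp_comp_const_add_cond {B : Set V} (hB0 : μ B ≠ 0) {f : V → ℝ} (hf : MemLp f p μ)
    (x : V) : MemLp (fun y => f (x + y)) p ((μ B)⁻¹ • μ.restrict B) :=
  ((hf.comp_measurePreserving (measurePreserving_add_left μ x)).restrict B).smul_measure
    (ENNReal.inv_ne_top.2 hB0)

/-- The normalised measure on `B` is a probability, so the average is at most an `Lᵖ` norm. The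
constant depends only on `B` and `p`; applied to a function it gives a uniform bound, applied to its
increments a Lipschitz bound. -/
lemma enorm_integral_comp_const_add_cond_le (hp1 : 1 ≤ p) (hp : p ≠ ⊤) {B : Set V}
    (hB0 : μ B ≠ 0) (hB : μ B ≠ ⊤) {f : V → ℝ} (hf : MemLp f p μ) (x : V) :
    ‖∫ y, f (x + y) ∂((μ B)⁻¹ • μ.restrict B)‖ₑ ≤
      (μ B)⁻¹ ^ (1 / p).toReal * eLpNorm f p μ := by
  have : IsProbabilityMeasure ((μ B)⁻¹ • μ.restrict B) :=
    ⟨by simp [ENNReal.inv_mul_cancel hB0 hB]⟩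
  have hm := measurePreserving_add_left μ x
  calc ‖∫ y, f (x + y) ∂((μ B)⁻¹ • μ.restrict B)‖ₑ
      ≤ eLpNorm (fun y => f (x + y)) 1 ((μ B)⁻¹ • μ.restrict B) := by
        rw [eLpNorm_one_eq_lintegral_enorm]
        exact enorm_integral_le_lintegral_enorm _
    _ ≤ eLpNorm (fun y => f (x + y)) p ((μ B)⁻¹ • μ.restrict B) :=
        eLpNorm_le_eLpNorm_of_exponent_le hp1 (memLp_comp_const_add_cond hB0 hf x).1
    _ = (μ B)⁻¹ ^ (1 / p).toReal * eLpNorm (fun y => f (x + y)) p (μ.restrict B) := by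
        rw [eLpNorm_smul_measure_of_ne_top hp, smul_eq_mul]
    _ ≤ (μ B)⁻¹ ^ (1 / p).toReal * eLpNorm f p μ := by
        gcongr
        refine (eLpNorm_mono_measure _ Measure.restrict_le_self).trans_eq ?_
        exact eLpNorm_comp_measurePreserving hf.1 hm

lemma eLpNorm_restrict_eq_of_ae_eq_zero {α E : Type*} [MeasurableSpace α] [NormedAddCommGroup E]
    {μ : Measure α} {f : α → E} {s : Set α} (hs : MeasurableSet s)
    (hf : ∀ᵐ x ∂μ, x ∉ s → f x = 0) : eLpNorm f p (μ.restrict s) = eLpNorm f p μ := by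
  rw [← eLpNorm_indicator_eq_eLpNorm_restrict hs]
  refine eLpNorm_congr_ae ?_
  filter_upwards [hf] with x hx
  by_cases hxs : x ∈ s
  · rw [Set.indicator_of_mem hxs]
  · rw [Set.indicator_of_notMem hxs, hx hxs]

variable [NormedSpace ℝ V] [FiniteDimensional ℝ V]

/-- The averages over a ball of a family that is bounded and uniformly Lipschitz under
translations in `Lᵖ` are totally bounded for the uniform convergence on a ball. -/
lemma exists_finite_average_net {ι : Type*} (hp1 : 1 ≤ p) (hp : p ≠ ⊤) {u : ι → V → ℝ}
    (hu : ∀ n, MemLp (u n) p μ) {M C : ℝ≥0} (hM : ∀ n, eLpNorm (u n) p μ ≤ M)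
    (hC : ∀ n h, eLpNorm (fun x => u n (x + h) - u n x) p μ ≤ C * ‖h‖ₑ) (R : ℝ)
    {B : Set V} (hB0 : μ B ≠ 0) (hB : μ B ≠ ⊤) {δ : ℝ} (hδ : 0 < δ) :
    ∃ I : Set ι, I.Finite ∧ ∀ n, ∃ m ∈ I, ∀ x ∈ Metric.closedBall (0 : V) R,
      |(∫ y, u n (x + y) ∂((μ B)⁻¹ • μ.restrict B)) -
        ∫ y, u m (x + y) ∂((μ B)⁻¹ • μ.restrict B)| ≤ δ := by
  have : IsProbabilityMeasure ((μ B)⁻¹ • μ.restrict B) :=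
    ⟨by simp [ENNReal.inv_mul_cancel hB0 hB]⟩
  set ν := (μ B)⁻¹ • μ.restrict B with hν
  obtain ⟨c, hc⟩ : ∃ c : ℝ≥0, (μ B)⁻¹ ^ (1 / p).toReal = c :=
    ⟨_, (ENNReal.coe_toNNReal (ENNReal.rpow_ne_top_of_nonneg ENNReal.toReal_nonneg
      (ENNReal.inv_ne_top.2 hB0))).symm⟩
  set v : ι → V → ℝ := fun n x => ∫ y, u n (x + y) ∂ν with hv
  have hbound : ∀ n x, ‖v n x‖ ≤ c * M := by
    intro n x
    have h1 := (enorm_integral_comp_const_add_cond_le hp1 hp hB0 hB (hu n) x).trans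
      (mul_le_mul_right (hM n) _)
    rw [hc, ← ENNReal.coe_mul, ← ofReal_norm,
      ENNReal.ofReal_le_iff_le_toReal ENNReal.coe_ne_top] at h1
    simpa only [ENNReal.coe_toReal, NNReal.coe_mul] using h1
  have hlip : ∀ n, LipschitzWith (c * C) (v n) := by
    intro n x x'
    have hx : ∀ x, Integrable (fun y => u n (x + y)) ν := fun x =>
      (memLp_comp_const_add_cond hB0 (hu n) x).integrable hp1
    -- The increment of the average is the average of the increment of `u n`, so the `Lᵖ`
    -- translation estimate becomes a pointwise one.
    have h1 : v n x - v n x' =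
        ∫ y, (fun z => u n (z + (x - x')) - u n z) (x' + y) ∂ν := by
      rw [hv, ← integral_sub (hx x) (hx x')]
      congr 1 with y
      congr 2
      abel
    rw [edist_eq_enorm_sub, edist_eq_enorm_sub, h1]
    have hf : MemLp (fun z => u n (z + (x - x')) - u n z) p μ :=
      ((hu n).comp_measurePreserving (measurePreserving_add_right μ (x - x'))).sub (hu n)
    refine (enorm_integral_comp_const_add_cond_le hp1 hp hB0 hB hf x').trans ?_
    rw [hc, ENNReal.coe_mul, mul_assoc]
    gcongr
    exact hC n _
  have : CompactSpace (Metric.closedBall (0 : V) R) :=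
    isCompact_iff_compactSpace.1 (isCompact_closedBall 0 R)
  let w : ι → BoundedContinuousFunction (Metric.closedBall (0 : V) R) ℝ := fun n =>
    BoundedContinuousFunction.mkOfCompact ⟨fun x => v n x, (hlip n).continuous.comp continuous_subtype_val⟩
  have hcomp : IsCompact (closure (Set.range w)) := by
    refine BoundedContinuousFunction.arzela_ascoli (Metric.closedBall (0 : ℝ) (c * M))
      (isCompact_closedBall _ _) _ ?_ ?_
    · rintro _ x ⟨n, rfl⟩
      rw [mem_closedBall_zero_iff]
      exact hbound n x
    · refine (LipschitzWith.uniformEquicontinuous _ (c * C) ?_).equicontinuous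
      rintro ⟨_, n, rfl⟩
      have h1 := (hlip n).comp (LipschitzWith.subtype_val (Metric.closedBall (0 : V) R))
      rwa [mul_one] at h1
  obtain ⟨t, hts, htf, htc⟩ := Metric.finite_approx_of_totallyBounded
    (hcomp.totallyBounded.subset subset_closure) δ hδ
  -- One index is kept for each member of the net, since `w` need not be injective.
  obtain ⟨I, hIt, hI⟩ := Set.exists_subset_bijOn (w ⁻¹' t) w
  refine ⟨I, hI.finite_iff_finite.2 (htf.subset (Set.image_preimage_subset _ _)), fun n => ?_⟩
  obtain ⟨y, hy, hny⟩ := Set.mem_iUnion₂.1 (htc ⟨n, rfl⟩)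
  obtain ⟨m, rfl⟩ := hts hy
  obtain ⟨m', hm', hmm'⟩ := hI.surjOn ⟨m, hy, rfl⟩
  refine ⟨m', hm', fun x hx => ?_⟩
  rw [← hmm'] at hny
  exact ((BoundedContinuousFunction.dist_coe_le_dist (f := w n) (g := w m') ⟨x, hx⟩).trans
    (Metric.mem_ball.1 hny).le)

/-- **Kolmogorov–Riesz**: a bounded family in `Lᵖ` that is supported in a fixed ball and is
uniformly Lipschitz under translations is relatively compact. -/
theorem exists_isCompact_toLp_mem {ι : Type*} [hp1 : Fact (1 ≤ p)] (hp : p ≠ ⊤) {u : ι → V → ℝ}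
    (hu : ∀ n, MemLp (u n) p μ) {M C : ℝ≥0} (hM : ∀ n, eLpNorm (u n) p μ ≤ M)
    (hC : ∀ n h, eLpNorm (fun x => u n (x + h) - u n x) p μ ≤ C * ‖h‖ₑ) {R : ℝ}
    (hR : ∀ n, ∀ᵐ x ∂μ, x ∉ Metric.closedBall (0 : V) R → u n x = 0) :
    ∃ K : Set (Lp ℝ p μ), IsCompact K ∧ ∀ n, (hu n).toLp (u n) ∈ K := by
  replace hp1 : 1 ≤ p := hp1.out
  refine ⟨closure (Set.range fun n => (hu n).toLp (u n)), ?_,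
    fun n => subset_closure ⟨n, rfl⟩⟩
  refine (TotallyBounded.closure ?_).isCompact_of_isClosed isClosed_closure
  rw [EMetric.totallyBounded_iff]
  intro ε hε
  obtain ⟨ε', hε', hεε'⟩ : ∃ ε' : ℝ≥0, 0 < ε' ∧ (ε' : ℝ≥0∞) < ε := by
    obtain ⟨ε', h1, h2⟩ := ENNReal.lt_iff_exists_nnreal_btwn.1 hε
    exact ⟨ε', by exact_mod_cast h1, h2⟩
  set D : Set V := Metric.closedBall (0 : V) R with hD
  have hDm : MeasurableSet D := Metric.isClosed_closedBall.measurableSet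
  obtain ⟨m, hm⟩ : ∃ m : ℝ≥0, (μ.restrict D) Set.univ ^ p.toReal⁻¹ = m := by
    refine ⟨_, (ENNReal.coe_toNNReal (ENNReal.rpow_ne_top_of_nonneg
      (inv_nonneg.2 ENNReal.toReal_nonneg) ?_)).symm⟩
    rw [Measure.restrict_apply_univ]
    exact measure_closedBall_lt_top.ne
  -- Averaging at scale `r` costs at most `C r`, and uniform closeness `δ` on `D` costs at most `m
  -- δ`; each is to be at most `ε' / 3`. The `+ 1` keeps the denominators positive.
  set r : ℝ≥0 := ε' / (3 * (C + 1)) with hr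
  set δ : ℝ≥0 := ε' / (3 * (m + 1)) with hδ
  have hr0 : 0 < r := by positivity
  have hδ0 : 0 < δ := by positivity
  have hCr : C * r ≤ ε' / 3 := by
    rw [hr, ← mul_div_assoc, div_le_div_iff₀ (by positivity) (by positivity)]
    nlinarith [mul_nonneg C.2 ε'.2, ε'.2, (show (0 : ℝ≥0) ≤ ε' from zero_le)]
  have hmδ : m * δ ≤ ε' / 3 := by
    rw [hδ, ← mul_div_assoc, div_le_div_iff₀ (by positivity) (by positivity)]
    nlinarith [mul_nonneg m.2 ε'.2, ε'.2, (show (0 : ℝ≥0) ≤ ε' from zero_le)]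
  set B : Set V := Metric.closedBall (0 : V) r with hBdef
  have hB0 : μ B ≠ 0 := (Metric.measure_closedBall_pos μ 0 (by exact_mod_cast hr0)).ne'
  have hB : μ B ≠ ⊤ := measure_closedBall_lt_top.ne
  have : IsProbabilityMeasure ((μ B)⁻¹ • μ.restrict B) :=
    ⟨by simp [ENNReal.inv_mul_cancel hB0 hB]⟩
  obtain ⟨I, hIf, hI⟩ := exists_finite_average_net hp1 hp hu hM hC R hB0 hB
    (δ := δ) (by exact_mod_cast hδ0)
  set ν := (μ B)⁻¹ • μ.restrict B with hν
  set v : ι → V → ℝ := fun n x => ∫ y, u n (x + y) ∂ν with hv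
  have hvm : ∀ n, AEStronglyMeasurable (v n) μ := fun n =>
    ((hu n).1.comp_measurePreserving
      (measurePreserving_add_comp (μ := μ) (ν := ν) measurable_id)).integral_prod_right'
  have hvu : ∀ n, eLpNorm (fun x => v n x - u n x) p μ ≤ (ε' / 3 : ℝ≥0) := by
    intro n
    refine (eLpNorm_integral_comp_add_sub_le (ν := ν) (τ := id) hp1 hp (hu n) measurable_id
      (C := C * r) ?_).trans (by exact_mod_cast hCr)
    refine Measure.ae_smul_measure ((ae_restrict_iff' Metric.isClosed_closedBall.measurableSet).2
      (ae_of_all _ fun y hy => (hC n y).trans ?_)) _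
    gcongr
    rw [← ofReal_norm, ← ENNReal.ofReal_coe_nnreal]
    exact ENNReal.ofReal_le_ofReal (mem_closedBall_zero_iff.1 hy)
  refine ⟨(fun n => (hu n).toLp (u n)) '' I, hIf.image _, ?_⟩
  rintro _ ⟨n, rfl⟩
  obtain ⟨k, hk, hnk⟩ := hI n
  refine Set.mem_iUnion₂.2 ⟨_, ⟨k, hk, rfl⟩, ?_⟩
  rw [Metric.mem_eball, Lp.edist_toLp_toLp]
  have h0 : ∀ᵐ x ∂μ, x ∉ D → (u n - u k) x = 0 := by
    filter_upwards [hR n, hR k] with x h1 h2 hx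
    rw [Pi.sub_apply, h1 hx, h2 hx, sub_zero]
  -- The averages are known to be close only on `D`, which carries both functions.
  rw [← eLpNorm_restrict_eq_of_ae_eq_zero hDm h0]
  have hsplit : u n - u k = ((fun x => v n x - v k x) - fun x => v n x - u n x) +
      fun x => v k x - u k x := by
    ext x
    simp
  have hmid : eLpNorm (fun x => v n x - v k x) p (μ.restrict D) ≤ (ε' / 3 : ℝ≥0) := by
    refine (eLpNorm_le_of_ae_bound (C := δ) ?_).trans ?_
    · exact (ae_restrict_iff' hDm).2 (ae_of_all _ hnk)
    · rw [hm, ENNReal.ofReal_coe_nnreal]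
      exact_mod_cast hmδ
  have hmn := fun n => ((hvm n).sub (hu n).1).restrict (s := D)
  rw [hsplit]
  calc eLpNorm (((fun x => v n x - v k x) - fun x => v n x - u n x) +
        fun x => v k x - u k x) p (μ.restrict D)
      ≤ eLpNorm (fun x => v n x - v k x) p (μ.restrict D) +
          eLpNorm (fun x => v n x - u n x) p (μ.restrict D) +
          eLpNorm (fun x => v k x - u k x) p (μ.restrict D) :=
        (eLpNorm_add_le ((((hvm n).sub (hvm k)).restrict).sub (hmn n)) (hmn k) hp1).trans
          (add_le_add_left (eLpNorm_sub_le (((hvm n).sub (hvm k)).restrict) (hmn n) hp1) _)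
    _ ≤ (ε' / 3 : ℝ≥0) + (ε' / 3 : ℝ≥0) + (ε' / 3 : ℝ≥0) := by
        gcongr
        · exact (eLpNorm_mono_measure _ Measure.restrict_le_self).trans (hvu n)
        · exact (eLpNorm_mono_measure _ Measure.restrict_le_self).trans (hvu k)
    _ = ε' := by
        norm_cast
        exact add_thirds ε'
    _ < ε := hεε'

end Compactness

/-! ### Weak limits in `Lᵖ` and strongly convergent subsequences -/

section WeakLimits

variable {α : Type*} [MeasurableSpace α] {μ : Measure α}

/-- An additive set function that is absolutely continuous, in the `ε`-`δ` sense, with respect to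
a finite measure has an integrable density. -/
lemma exists_integrable_density [IsFiniteMeasure μ] {m : Set α → ℝ}
    (hadd : ∀ A B, MeasurableSet A → MeasurableSet B → Disjoint A B → m (A ∪ B) = m A + m B)
    {κ : ℝ≥0∞ → ℝ} (hκ : Tendsto κ (𝓝 0) (𝓝 0))
    (hm : ∀ A, MeasurableSet A → |m A| ≤ κ (μ A)) :
    ∃ F : α → ℝ, Measurable F ∧ Integrable F μ ∧
      ∀ A, MeasurableSet A → ∫ x in A, F x ∂μ = m A := by
  classical
  have hempty : m ∅ = 0 := by
    have := hadd ∅ ∅ MeasurableSet.empty MeasurableSet.empty (Set.disjoint_empty _)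
    simpa using this
  have hfin : ∀ (f : ℕ → Set α), (∀ i, MeasurableSet (f i)) → Pairwise (Function.onFun Disjoint f) →
      ∀ s : Finset ℕ, m (⋃ i ∈ s, f i) = ∑ i ∈ s, m (f i) := by
    intro f hf hd s
    induction s using Finset.induction_on with
    | empty => simpa using hempty
    | insert a s has ih =>
      rw [Finset.set_biUnion_insert, hadd _ _ (hf a) (s.measurableSet_biUnion fun i _ => hf i),
        ih, Finset.sum_insert has]
      refine Set.disjoint_iUnion₂_right.2 fun i hi => hd ?_
      rintro rfl
      exact has hi
  let S : SignedMeasure α :=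
    { measureOf' := fun A => if MeasurableSet A then m A else 0
      empty' := by simp [hempty]
      not_measurable' := fun A hA => if_neg hA
      m_iUnion' := by
        intro f hf hd
        simp only [hf, MeasurableSet.iUnion hf, if_true]
        -- Countable additivity: the tails have measure tending to zero, hence by `hm` also
        -- vanishing `m`-mass.
        have htail : Tendsto (fun s : Finset ℕ => μ (⋃ i : {i // i ∉ s}, f i)) atTop (𝓝 0) := by
          refine tendsto_of_tendsto_of_tendsto_of_le_of_le tendsto_const_nhds
            (ENNReal.tendsto_tsum_compl_atTop_zero (f := fun i => μ (f i)) ?_)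
            (fun _ => zero_le) fun s => measure_iUnion_le _
          rw [← measure_iUnion hd hf]
          exact measure_ne_top _ _
        have hlim := squeeze_zero_norm (f := fun s : Finset ℕ => m (⋃ i : {i // i ∉ s}, f i)) (fun s : Finset ℕ => hm (⋃ i : {i // i ∉ s}, f i)
          (MeasurableSet.iUnion fun i => hf i)) (hκ.comp htail)
        have := hlim.const_sub (m (⋃ i, f i))
        rw [sub_zero] at this
        refine this.congr fun s => ?_
        rw [← hfin f hf hd s, sub_eq_iff_eq_add, ← hadd]
        · congr 1
          ext x
          simp only [Set.mem_iUnion, Set.mem_union, exists_prop, Subtype.exists]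
          constructor
          · rintro ⟨i, hi⟩
            by_cases h : i ∈ s
            · exact Or.inl ⟨i, h, hi⟩
            · exact Or.inr ⟨i, h, hi⟩
          · rintro (⟨i, -, hi⟩ | ⟨i, -, hi⟩) <;> exact ⟨i, hi⟩
        · exact s.measurableSet_biUnion fun i _ => hf i
        · exact MeasurableSet.iUnion fun i => hf i
        · refine Set.disjoint_iUnion₂_left.2 fun i hi => Set.disjoint_iUnion_right.2 fun j => hd ?_
          rintro rfl
          exact j.2 hi }
  have hSA : ∀ A, MeasurableSet A → S A = m A := fun A hA => if_pos hA
  have hS : S ≪ᵥ μ.toENNRealVectorMeasure := by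
    refine VectorMeasure.AbsolutelyContinuous.mk fun A hA hμA => ?_
    rw [Measure.toENNRealVectorMeasure_apply_measurable hA] at hμA
    rw [hSA A hA]
    have h1 := hm A hA
    -- The full neighbourhood filter contains the point itself, so the limit at `0` forces `κ 0 =
    -- 0`.
    rw [hμA, tendsto_nhds_unique (tendsto_pure_nhds κ 0) (hκ.mono_left (pure_le_nhds 0))] at h1
    exact abs_nonpos_iff.1 h1
  refine ⟨S.rnDeriv μ, SignedMeasure.measurable_rnDeriv _ _, SignedMeasure.integrable_rnDeriv _ _,
    fun A hA => ?_⟩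
  rw [← hSA A hA, ← withDensityᵥ_apply (SignedMeasure.integrable_rnDeriv _ _) hA,
    (SignedMeasure.absolutelyContinuous_iff_withDensityᵥ_rnDeriv_eq S μ).1 hS]

/-- A bounded measurable function is uniformly approximated by simple functions. -/
lemma exists_simpleFunc_abs_sub_le {φ : α → ℝ} (hφ : Measurable φ) {c : ℝ}
    (hc : ∀ x, |φ x| ≤ c) {ε : ℝ} (hε : 0 < ε) : ∃ s : SimpleFunc α ℝ, ∀ x, |φ x - s x| ≤ ε := by
  refine ⟨⟨fun x => ε * (⌊φ x / ε⌋ : ℝ), fun y => ?_, ?_⟩, fun x => ?_⟩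
  · exact measurableSet_preimage
      (measurable_const.mul ((measurable_of_countable fun z : ℤ => (z : ℝ)).comp
        (hφ.div_const ε).floor)) (measurableSet_singleton y)
  · refine ((Set.finite_Icc ⌊-c / ε⌋ ⌊c / ε⌋).image fun z : ℤ => ε * (z : ℝ)).subset ?_
    rintro _ ⟨x, rfl⟩
    exact ⟨_, ⟨Int.floor_le_floor (by gcongr; exact (abs_le.1 (hc x)).1),
      Int.floor_le_floor (by gcongr; exact (abs_le.1 (hc x)).2)⟩, rfl⟩
  · change |φ x - ε * (⌊φ x / ε⌋ : ℝ)| ≤ ε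
    have h1 := Int.floor_le (φ x / ε)
    have h2 := Int.lt_floor_add_one (φ x / ε)
    rw [le_div_iff₀ hε] at h1
    rw [div_lt_iff₀ hε] at h2
    rw [abs_le]
    constructor <;> nlinarith

/-- Convergence of the integrals over measurable sets upgrades to convergence against bounded
measurable functions. -/
lemma tendsto_integral_mul_of_tendsto_setIntegral {ι : Type*} {l : Filter ι} {f : ι → α → ℝ}
    {F : α → ℝ} (hf : ∀ n, Integrable (f n) μ) (hF : Integrable F μ) {K : ℝ}
    (hK : ∀ n, ∫ x, |f n x| ∂μ ≤ K)
    (h : ∀ A, MeasurableSet A → Tendsto (fun n => ∫ x in A, f n x ∂μ) l (𝓝 (∫ x in A, F x ∂μ)))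
    {φ : α → ℝ} (hφ : Measurable φ) {c : ℝ} (hc : ∀ x, |φ x| ≤ c) :
    Tendsto (fun n => ∫ x, φ x * f n x ∂μ) l (𝓝 (∫ x, φ x * F x ∂μ)) := by
  have hsbdd : ∀ s : SimpleFunc α ℝ, ∃ c, ∀ x, ‖s x‖ ≤ c := fun s => s.exists_forall_norm_le
  have hsint : ∀ (s : SimpleFunc α ℝ) {G : α → ℝ}, Integrable G μ →
      Integrable (fun x => s x * G x) μ := fun s G hG => by
    obtain ⟨c, hc⟩ := hsbdd s
    exact hG.bdd_mul s.aestronglyMeasurable (ae_of_all _ hc)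
  have hsimple : ∀ s : SimpleFunc α ℝ,
      Tendsto (fun n => ∫ x, s x * f n x ∂μ) l (𝓝 (∫ x, s x * F x ∂μ)) := by
    intro s
    induction s using SimpleFunc.induction with
    | @const a A hA =>
      have h1 : ∀ G : α → ℝ, ∫ x, (SimpleFunc.piecewise A hA (SimpleFunc.const α a)
          (SimpleFunc.const α 0)) x * G x ∂μ = a * ∫ x in A, G x ∂μ := by
        intro G
        rw [← integral_indicator hA, ← integral_const_mul]
        refine integral_congr_ae (ae_of_all _ fun x => ?_)
        by_cases hx : x ∈ A <;> simp [hx]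
      simp only [h1]
      exact (h A hA).const_mul a
    | @add s t _ hs ht =>
      have h1 : ∀ G : α → ℝ, Integrable G μ → ∫ x, (s + t) x * G x ∂μ =
          (∫ x, s x * G x ∂μ) + ∫ x, t x * G x ∂μ := by
        intro G hG
        rw [← integral_add (hsint s hG) (hsint t hG)]
        simp [add_mul]
      simp only [h1 _ (hf _), h1 _ hF]
      exact hs.add ht
  have hφint : ∀ {G : α → ℝ}, Integrable G μ → Integrable (fun x => φ x * G x) μ :=
    fun hG => hG.bdd_mul hφ.aestronglyMeasurable (ae_of_all _ hc)
  have happrox : ∀ {s : SimpleFunc α ℝ} {ε : ℝ}, (∀ x, |φ x - s x| ≤ ε) → ∀ {G : α → ℝ},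
      Integrable G μ → |(∫ x, φ x * G x ∂μ) - ∫ x, s x * G x ∂μ| ≤ ε * ∫ x, |G x| ∂μ := by
    intro s ε hs G hG
    rw [← integral_sub (hφint hG) (hsint s hG), ← integral_const_mul]
    refine norm_integral_le_of_norm_le (f := fun x => φ x * G x - s x * G x) (hG.abs.const_mul ε) (ae_of_all _ fun x => ?_)
    rw [← sub_mul, norm_mul]
    exact mul_le_mul_of_nonneg_right (hs x) (abs_nonneg _)
  rw [Metric.tendsto_nhds]
  intro ε hε
  have hK0 : 0 ≤ ∫ x, |F x| ∂μ := integral_nonneg fun _ => abs_nonneg _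
  set L : ℝ := max K (∫ x, |F x| ∂μ) + 1 with hL
  have hL0 : 0 < L := by positivity
  obtain ⟨s, hs⟩ := exists_simpleFunc_abs_sub_le hφ hc (ε := ε / (3 * L)) (by positivity)
  filter_upwards [Metric.tendsto_nhds.1 (hsimple s) (ε / 3) (by positivity)] with n hn
  rw [Real.dist_eq] at hn ⊢
  have hsmall : ∀ {G : α → ℝ}, ∫ x, |G x| ∂μ ≤ L → ε / (3 * L) * ∫ x, |G x| ∂μ ≤ ε / 3 := by
    intro G hG
    calc ε / (3 * L) * ∫ x, |G x| ∂μ ≤ ε / (3 * L) * L := by gcongr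
      _ = ε / 3 := by field_simp
  have h1 := (happrox hs (hf n)).trans
    (hsmall ((hK n).trans ((le_max_left _ _).trans (le_add_of_nonneg_right zero_le_one))))
  have h2 := (happrox hs hF).trans
    (hsmall ((le_max_right _ _).trans (le_add_of_nonneg_right zero_le_one)))
  rw [abs_le] at h1 h2
  rw [abs_lt] at hn ⊢
  constructor <;> linarith

/-- Weak limits along an ultrafilter of bounded sequences in `Lᵖ`, `p > 1`, on a finite measure
space. -/
lemma exists_weak_limit [IsFiniteMeasure μ] {p : ℝ≥0∞} (hp1 : 1 < p) {ι : Type*}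
    (U : Ultrafilter ι) {f : ι → α → ℝ} (hf : ∀ n, MemLp (f n) p μ) {C : ℝ≥0}
    (hC : ∀ n, eLpNorm (f n) p μ ≤ C) :
    ∃ F : α → ℝ, Measurable F ∧ Integrable F μ ∧ ∀ φ : α → ℝ, Measurable φ →
      ∀ c : ℝ, (∀ x, |φ x| ≤ c) →
        Tendsto (fun n => ∫ x, φ x * f n x ∂μ) U (𝓝 (∫ x, φ x * F x ∂μ)) := by
  have hfi : ∀ n, Integrable (f n) μ := fun n => (hf n).integrable hp1.le
  -- Here `θ = 1 - 1/p` is the Hölder exponent in `∫_A |f n| ≤ C μ(A)^θ`. It is positive because `p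
  -- > 1`, which makes the sequence uniformly integrable.
  set θ : ℝ := 1 / (1 : ℝ≥0∞).toReal - 1 / p.toReal with hθ
  have hθ0 : 0 < θ := by
    rcases eq_or_ne p ⊤ with rfl | hp
    · simp [hθ]
    · have : 1 < p.toReal := by
        rw [← ENNReal.toReal_one]
        exact (ENNReal.toReal_lt_toReal ENNReal.one_ne_top hp).2 hp1
      rw [hθ, ENNReal.toReal_one, sub_pos, one_div_one]
      exact (div_lt_one (by linarith)).2 this
  set κ : ℝ≥0∞ → ℝ := fun x => (C * x ^ θ).toReal with hκ
  have hbound : ∀ n A, ∫ x in A, |f n x| ∂μ ≤ κ (μ A) := by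
    intro n A
    change ∫ x in A, ‖f n x‖ ∂μ ≤ _
    rw [integral_norm_eq_lintegral_enorm (hf n).1.restrict]
    refine ENNReal.toReal_mono (ENNReal.mul_ne_top ENNReal.coe_ne_top
      (ENNReal.rpow_ne_top_of_nonneg hθ0.le (measure_ne_top _ _))) ?_
    rw [← eLpNorm_one_eq_lintegral_enorm]
    refine (eLpNorm_le_eLpNorm_mul_rpow_measure_univ hp1.le (hf n).1.restrict).trans ?_
    rw [Measure.restrict_apply_univ]
    gcongr
    exact (eLpNorm_mono_measure _ Measure.restrict_le_self).trans (hC n)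
  have hbound' : ∀ n A, |∫ x in A, f n x ∂μ| ≤ κ (μ A) := fun n A =>
    (norm_integral_le_integral_norm (f n)).trans (hbound n A)
  -- The ultrafilter supplies a limit for every set `A` at once, without a diagonal extraction.
  have hex : ∀ A, ∃ y ∈ Set.Icc (-κ (μ A)) (κ (μ A)),
      Tendsto (fun n => ∫ x in A, f n x ∂μ) U (𝓝 y) := by
    intro A
    exact isCompact_Icc.ultrafilter_le_nhds' (U.map fun n => ∫ x in A, f n x ∂μ)
      (Ultrafilter.mem_map.2 (univ_mem' fun n => abs_le.1 (hbound' n A)))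
  choose m hm hmlim using hex
  have hκ0 : Tendsto κ (𝓝 0) (𝓝 0) := by
    have h1 : Tendsto (fun x : ℝ≥0∞ => C * x ^ θ) (𝓝 0) (𝓝 (C * 0 ^ θ)) :=
      ENNReal.Tendsto.const_mul ((ENNReal.continuous_rpow_const (y := θ)).tendsto 0)
        (Or.inr ENNReal.coe_ne_top)
    rw [ENNReal.zero_rpow_of_pos hθ0, mul_zero] at h1
    exact (ENNReal.tendsto_toReal ENNReal.zero_ne_top).comp h1
  obtain ⟨F, hFm, hFi, hF⟩ := exists_integrable_density (μ := μ) (m := m) (fun A B hA hB hAB => by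
    refine tendsto_nhds_unique (hmlim (A ∪ B)) (((hmlim A).add (hmlim B)).congr fun n => ?_)
    exact (setIntegral_union hAB hB (hfi n).integrableOn (hfi n).integrableOn).symm)
    hκ0 fun A _ => abs_le.2 (hm A)
  refine ⟨F, hFm, hFi, fun φ hφ c hc => ?_⟩
  refine tendsto_integral_mul_of_tendsto_setIntegral (K := κ (μ Set.univ)) hfi hFi (fun n => ?_)
    (fun A hA => ?_) hφ hc
  · simpa using hbound n Set.univ
  · rw [hF A hA]
    exact hmlim A

end WeakLimits

lemma exists_nnreal_bound_of_tendsto {a : ℕ → ℝ≥0∞} (ha : ∀ n, a n ≠ ⊤) {v : ℝ≥0}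
    (h : Tendsto a atTop (𝓝 v)) : ∃ C : ℝ≥0, ∀ n, a n ≤ C := by
  lift a to ℕ → ℝ≥0 using ha
  obtain ⟨C, hC⟩ := (ENNReal.tendsto_coe.1 h).bddAbove_range
  exact ⟨C, fun n => ENNReal.coe_le_coe.2 (hC ⟨n, rfl⟩)⟩

lemma eLpNorm_ofReal_rpow {α E : Type*} [MeasurableSpace α] [NormedAddCommGroup E] {μ : Measure α}
    {p : ℝ} (hp : 0 < p) (f : α → E) :
    eLpNorm f (ENNReal.ofReal p) μ ^ p = ∫⁻ x, ‖f x‖ₑ ^ p ∂μ := by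
  rw [eLpNorm_eq_lintegral_rpow_enorm_toReal (ENNReal.ofReal_pos.2 hp).ne' ENNReal.ofReal_ne_top,
    ENNReal.toReal_ofReal hp.le, ← ENNReal.rpow_mul, one_div, inv_mul_cancel₀ hp.ne',
    ENNReal.rpow_one]

/-- Weak compactness in `Lᵖ`, with the lower semicontinuity of the norm. -/
lemma exists_weak_limit_vector {α : Type*} [MeasurableSpace α] {μ : Measure α} [IsFiniteMeasure μ]
    {d : ℕ} {p : ℝ} (hp1 : 1 < p) {g : ℕ → α → EuclideanSpace ℝ (Fin d)}
    (hg : ∀ n, MemLp (g n) (ENNReal.ofReal p) μ) {a : ℕ → ℝ≥0∞} (ha : ∀ n, a n ≠ ⊤)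
    (hga : ∀ n, ∫⁻ x, ‖g n x‖ₑ ^ p ∂μ ≤ a n) {v : ℝ≥0} (hav : Tendsto a atTop (𝓝 v)) :
    ∃ G : α → EuclideanSpace ℝ (Fin d), MemLp G (ENNReal.ofReal p) μ ∧
      ∫⁻ x, ‖G x‖ₑ ^ p ∂μ ≤ v ∧ ∀ φ : α → ℝ, Measurable φ → ∀ c : ℝ, (∀ x, |φ x| ≤ c) →
        ∀ i, Tendsto (fun n => ∫ x, φ x * g n x i ∂μ) (hyperfilter ℕ)
          (𝓝 (∫ x, φ x * G x i ∂μ)) := by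
  have hp0 : 0 < p := one_pos.trans hp1
  have hp1' : 1 < ENNReal.ofReal p := by
    rw [← ENNReal.ofReal_one]
    exact (ENNReal.ofReal_lt_ofReal_iff hp0).2 hp1
  obtain ⟨K, hK⟩ := exists_nnreal_bound_of_tendsto ha hav
  have hnorm : ∀ n, eLpNorm (g n) (ENNReal.ofReal p) μ ≤ (K ^ p⁻¹ : ℝ≥0) := by
    intro n
    rw [← ENNReal.rpow_le_rpow_iff hp0, eLpNorm_ofReal_rpow hp0,
      ← ENNReal.coe_rpow_of_nonneg _ hp0.le, NNReal.rpow_inv_rpow hp0.ne']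
    exact (hga n).trans (hK n)
  have hgi : ∀ n i, MemLp (fun x => g n x i) (ENNReal.ofReal p) μ := fun n i =>
    (EuclideanSpace.proj (𝕜 := ℝ) i).comp_memLp' (hg n)
  have hgi_le : ∀ i n, eLpNorm (fun x => g n x i) (ENNReal.ofReal p) μ ≤ (K ^ p⁻¹ : ℝ≥0) :=
    fun i n => (eLpNorm_mono fun x => PiLp.norm_apply_le (g n x) i).trans (hnorm n)
  choose F hFm hFi hF using fun i =>
    exists_weak_limit hp1' (hyperfilter ℕ) (fun n => hgi n i) (hgi_le i)
  set G : α → EuclideanSpace ℝ (Fin d) := fun x => WithLp.toLp 2 fun i => F i x with hG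
  have hGm : Measurable G :=
    (PiLp.continuous_toLp 2 _).measurable.comp (measurable_pi_lambda _ hFm)
  -- Weak convergence is available only against bounded functions, so the dual field is truncated
  -- where `‖G‖` is large.
  set A : ℕ → Set α := fun M => {x | ‖G x‖ ≤ M} with hA
  have hAm : ∀ M, MeasurableSet (A M) := fun M => measurableSet_le hGm.norm measurable_const
  have hcut : ∀ M : ℕ, ∫⁻ x in A M, ‖G x‖ₑ ^ p ∂μ ≤ v := by
    intro M
    -- The dual field of `G`: on `A M` it satisfies `⟨ψ, G⟩ = ‖G‖ ^ p = ‖ψ‖ ^ q`, the equality case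
    -- of Young's inequality.
    set ψ : α → EuclideanSpace ℝ (Fin d) := (A M).indicator fun x => ‖G x‖ ^ (p - 2) • G x with hψ
    have hψm : Measurable ψ := ((hGm.norm.pow_const _).smul hGm).indicator (hAm M)
    have hψnorm : ∀ x, ‖ψ x‖ = (A M).indicator (fun x => ‖G x‖ ^ (p - 1)) x := by
      intro x
      by_cases hx : x ∈ A M
      · rw [hψ, Set.indicator_of_mem hx, Set.indicator_of_mem hx, norm_smul,
          Real.norm_of_nonneg (by positivity)]
        rcases eq_or_ne ‖G x‖ 0 with h0 | h0
        · rw [h0, mul_zero, Real.zero_rpow (by linarith)]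
        · rw [show p - 1 = p - 2 + 1 by ring, Real.rpow_add_one h0]
      · rw [hψ, Set.indicator_of_notMem hx, Set.indicator_of_notMem hx, norm_zero]
    have hψb : ∀ x, ‖ψ x‖ ≤ (M : ℝ) ^ (p - 1) := by
      intro x
      rw [hψnorm]
      by_cases hx : x ∈ A M
      · rw [Set.indicator_of_mem hx]
        exact Real.rpow_le_rpow (norm_nonneg _) hx (by linarith)
      · rw [Set.indicator_of_notMem hx]
        positivity
    set W : α → ℝ := (A M).indicator fun x => ‖G x‖ ^ p with hW
    have hWint : Integrable W μ := by
      refine Integrable.of_bound (C := (M : ℝ) ^ p)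
        ((hGm.norm.pow_const _).indicator (hAm M)).aestronglyMeasurable (ae_of_all _ fun x => ?_)
      by_cases hx : x ∈ A M
      · rw [hW, Set.indicator_of_mem hx, Real.norm_of_nonneg (by positivity)]
        exact Real.rpow_le_rpow (norm_nonneg _) hx hp0.le
      · rw [hW, Set.indicator_of_notMem hx, norm_zero]
        positivity
    have hψG : ∀ x, inner ℝ (ψ x) (G x) = W x := by
      intro x
      by_cases hx : x ∈ A M
      · rw [hψ, hW, Set.indicator_of_mem hx, Set.indicator_of_mem hx, real_inner_smul_left,
          real_inner_self_eq_norm_sq]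
        rcases eq_or_ne ‖G x‖ 0 with h0 | h0
        · rw [h0, Real.zero_rpow hp0.ne']
          ring
        · rw [← Real.rpow_natCast ‖G x‖ 2, ← Real.rpow_add (lt_of_le_of_ne (norm_nonneg _) h0.symm)]
          congr 1
          push_cast
          ring
      · rw [hψ, hW, Set.indicator_of_notMem hx, Set.indicator_of_notMem hx, inner_zero_left]
    have hq := Real.HolderConjugate.conjExponent hp1
    set q := p.conjExponent with hqdef
    have hψq : ∀ x, ‖ψ x‖ ^ q = W x := by
      intro x
      rw [hψnorm]
      by_cases hx : x ∈ A M
      · rw [hW, Set.indicator_of_mem hx, Set.indicator_of_mem hx, ← Real.rpow_mul (norm_nonneg _),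
          hq.sub_one_mul_conj]
      · rw [hW, Set.indicator_of_notMem hx, Set.indicator_of_notMem hx,
          Real.zero_rpow hq.symm.ne_zero]
    have hψi : ∀ i x, |ψ x i| ≤ (M : ℝ) ^ (p - 1) := fun i x =>
      (PiLp.norm_apply_le (ψ x) i).trans (hψb x)
    have hψim : ∀ i, Measurable fun x => ψ x i := fun i =>
      (EuclideanSpace.proj (𝕜 := ℝ) i).continuous.measurable.comp hψm
    have hsum : ∀ {H : α → EuclideanSpace ℝ (Fin d)}, (∀ i, Integrable (fun x => H x i) μ) →
        ∫ x, inner ℝ (ψ x) (H x) ∂μ = ∑ i, ∫ x, ψ x i * H x i ∂μ := by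
      intro H hH
      rw [← integral_finsetSum]
      · refine integral_congr_ae (ae_of_all _ fun x => ?_)
        simp [PiLp.inner_apply, mul_comm]
      · exact fun i _ => (hH i).bdd_mul (hψim i).aestronglyMeasurable (ae_of_all _ (hψi i))
    have hlim : Tendsto (fun n => ∫ x, inner ℝ (ψ x) (g n x) ∂μ) (hyperfilter ℕ)
        (𝓝 (∫ x, W x ∂μ)) := by
      simp only [← hψG]
      rw [hsum (H := G) hFi]
      simp only [hsum fun i => (hgi _ i).integrable hp1'.le]
      exact tendsto_finsetSum _ fun i _ => hF i _ (hψim i) _ (hψi i)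
    have hgint : ∀ n, Integrable (fun x => ‖g n x‖ ^ p) μ := fun n => by
      have := (hg n).integrable_norm_rpow (ENNReal.ofReal_pos.2 hp0).ne' ENNReal.ofReal_ne_top
      rwa [ENNReal.toReal_ofReal hp0.le] at this
    have hgreal : ∀ n, ∫ x, ‖g n x‖ ^ p ∂μ ≤ (a n).toReal := by
      intro n
      rw [integral_eq_lintegral_of_nonneg_ae (ae_of_all _ fun x => by positivity) (hgint n).1]
      refine ENNReal.toReal_mono (ha n) (le_trans (le_of_eq ?_) (hga n))
      refine lintegral_congr fun x => ?_
      rw [← ENNReal.ofReal_rpow_of_nonneg (norm_nonneg _) hp0.le, ofReal_norm]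
    have hyoung : ∀ n, ∫ x, inner ℝ (ψ x) (g n x) ∂μ ≤
        (∫ x, W x ∂μ) / q + (a n).toReal / p := by
      intro n
      have hle : ∀ x, inner ℝ (ψ x) (g n x) ≤ W x / q + ‖g n x‖ ^ p / p := by
        intro x
        rw [← hψq]
        exact (real_inner_le_norm _ _).trans
          (Real.young_inequality_of_nonneg (norm_nonneg _) (norm_nonneg _) hq.symm)
      have hint : Integrable (fun x => inner ℝ (ψ x) (g n x)) μ := by
        refine (((hg n).integrable hp1'.le).norm.const_mul ((M : ℝ) ^ (p - 1))).mono'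
          (hψm.aestronglyMeasurable.inner (hg n).1) (ae_of_all _ fun x => ?_)
        exact (norm_inner_le_norm _ _).trans
          (mul_le_mul_of_nonneg_right (hψb x) (norm_nonneg _))
      calc ∫ x, inner ℝ (ψ x) (g n x) ∂μ ≤ ∫ x, (W x / q + ‖g n x‖ ^ p / p) ∂μ :=
            integral_mono hint ((hWint.div_const q).add ((hgint n).div_const p)) hle
        _ = (∫ x, W x ∂μ) / q + (∫ x, ‖g n x‖ ^ p ∂μ) / p := by
            rw [integral_add (hWint.div_const q) ((hgint n).div_const p), integral_div,
              integral_div]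
        _ ≤ (∫ x, W x ∂μ) / q + (a n).toReal / p := by
            gcongr
            exact hgreal n
    have hav' : Tendsto (fun n => (∫ x, W x ∂μ) / q + (a n).toReal / p) (hyperfilter ℕ)
        (𝓝 ((∫ x, W x ∂μ) / q + (v : ℝ) / p)) :=
      (((ENNReal.tendsto_toReal ENNReal.coe_ne_top).comp hav).div_const p |>.const_add _).mono_left
        Nat.hyperfilter_le_atTop
    -- The limit of Young's inequality reads `∫ W ≤ (∫ W) / q + v / p`; as `∫ W` is finite, `1/p +
    -- 1/q = 1` allows absorption.
    have hIle : ∫ x, W x ∂μ ≤ v := by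
      have h1 := le_of_tendsto_of_tendsto' hlim hav' hyoung
      have h2 : p⁻¹ * (∫ x, W x ∂μ) + q⁻¹ * (∫ x, W x ∂μ) = ∫ x, W x ∂μ := by
        rw [← add_mul, hq.inv_add_inv_eq_one, one_mul]
      have h3 : p⁻¹ * (∫ x, W x ∂μ) ≤ p⁻¹ * v := by
        rw [div_eq_inv_mul, div_eq_inv_mul] at h1
        linarith
      exact le_of_mul_le_mul_left h3 (inv_pos.2 hp0)
    rw [← lintegral_indicator (hAm M)]
    calc ∫⁻ x, (A M).indicator (fun x => ‖G x‖ₑ ^ p) x ∂μ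
        = ∫⁻ x, ENNReal.ofReal (W x) ∂μ := by
          refine lintegral_congr fun x => ?_
          by_cases hx : x ∈ A M
          · rw [hW, Set.indicator_of_mem hx, Set.indicator_of_mem hx,
              ← ENNReal.ofReal_rpow_of_nonneg (norm_nonneg _) hp0.le, ofReal_norm]
          · rw [hW, Set.indicator_of_notMem hx, Set.indicator_of_notMem hx, ENNReal.ofReal_zero]
      _ = ENNReal.ofReal (∫ x, W x ∂μ) :=
          (ofReal_integral_eq_lintegral_ofReal hWint (ae_of_all _ fun x =>
            Set.indicator_nonneg (fun _ _ => by positivity) x)).symm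
      _ ≤ v := by
          rw [← ENNReal.ofReal_coe_nnreal]
          exact ENNReal.ofReal_le_ofReal hIle
  have hAmono : Monotone A := fun M N hMN x hx => le_trans (show ‖G x‖ ≤ M from hx) (by exact_mod_cast hMN)
  have hAuniv : ⋃ M, A M = Set.univ := Set.eq_univ_of_forall fun x =>
    Set.mem_iUnion.2 (exists_nat_ge ‖G x‖)
  have hGv : ∫⁻ x, ‖G x‖ₑ ^ p ∂μ ≤ v := by
    rw [← setLIntegral_univ, ← hAuniv, setLIntegral_iUnion_of_directed _ hAmono.directed_le]
    exact iSup_le hcut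
  refine ⟨G, ⟨hGm.aestronglyMeasurable, ?_⟩, hGv, fun φ hφ c hc i => hF i φ hφ c hc⟩
  rw [← ENNReal.rpow_lt_top_iff_of_pos hp0, eLpNorm_ofReal_rpow hp0]
  exact hGv.trans_lt ENNReal.coe_lt_top

/-- Along a common subsequence, finitely many families satisfying the assumptions of the
Kolmogorov–Riesz theorem converge in `Lᵖ` and almost everywhere. -/
theorem exists_subseq_tendsto_eLpNorm {V : Type*} [NormedAddCommGroup V] [NormedSpace ℝ V]
    [FiniteDimensional ℝ V] [MeasurableSpace V] [BorelSpace V] {μ : Measure V} [μ.IsAddHaarMeasure]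
    {p : ℝ≥0∞} (hp1 : 1 ≤ p) (hp : p ≠ ⊤) {N : ℕ} {u : ℕ → Fin N → V → ℝ}
    (hu : ∀ n i, MemLp (u n i) p μ) {M C : ℝ≥0} (hM : ∀ n i, eLpNorm (u n i) p μ ≤ M)
    (hC : ∀ n i h, eLpNorm (fun x => u n i (x + h) - u n i x) p μ ≤ C * ‖h‖ₑ) {R : ℝ}
    (hR : ∀ n i, ∀ᵐ x ∂μ, x ∉ Metric.closedBall (0 : V) R → u n i x = 0) :
    ∃ (φ : ℕ → ℕ) (w : Fin N → V → ℝ), StrictMono φ ∧ (∀ i, MemLp (w i) p μ) ∧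
      (∀ i, Tendsto (fun n => eLpNorm (u (φ n) i - w i) p μ) atTop (𝓝 0)) ∧
      ∀ᵐ x ∂μ, ∀ i, Tendsto (fun n => u (φ n) i x) atTop (𝓝 (w i x)) := by
  have : Fact (1 ≤ p) := ⟨hp1⟩
  obtain ⟨K, hK, huK⟩ := exists_isCompact_toLp_mem (ι := ℕ × Fin N) (u := fun z => u z.1 z.2) hp
    (fun z => hu z.1 z.2) (fun z => hM z.1 z.2) (fun z => hC z.1 z.2) (fun z => hR z.1 z.2)
  -- Compactness of the product set gives one subsequence for all components.
  obtain ⟨w, -, φ, hφ, hlim⟩ := (isCompact_univ_pi fun _ : Fin N => hK).tendsto_subseq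
    (x := fun n i => (hu n i).toLp (u n i)) fun n i _ => huK (n, i)
  have hLp : ∀ i, Tendsto (fun n => eLpNorm (u (φ n) i - ⇑(w i)) p μ) atTop (𝓝 0) := by
    intro i
    have h1 := (Lp.tendsto_Lp_iff_tendsto_eLpNorm' _ _).1 (tendsto_pi_nhds.1 hlim i)
    refine h1.congr fun n => eLpNorm_congr_ae ?_
    exact (hu (φ n) i).coeFn_toLp.sub EventuallyEq.rfl
  have hm : ∀ n i, AEStronglyMeasurable (fun x => |u (φ n) i x - w i x|) μ := fun n i =>
    ((hu (φ n) i).1.sub (Lp.memLp (w i)).1).norm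
  -- Summing the errors lets a single further extraction give a.e. convergence of all components.
  have hsum : Tendsto (fun n => eLpNorm ((fun x => ∑ i, |u (φ n) i x - w i x|) - fun _ => 0) p μ)
      atTop (𝓝 0) := by
    have h1 : Tendsto (fun n => ∑ i, eLpNorm (u (φ n) i - ⇑(w i)) p μ) atTop (𝓝 0) := by
      simpa using tendsto_finsetSum (Finset.univ : Finset (Fin N)) fun i _ => hLp i
    refine tendsto_of_tendsto_of_tendsto_of_le_of_le tendsto_const_nhds h1 (fun _ => zero_le)
      fun n => ?_
    have h2 : ((fun x => ∑ i, |u (φ n) i x - w i x|) - fun _ => 0) =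
        ∑ i, fun x => |u (φ n) i x - w i x| := by
      ext x
      simp
    rw [h2]
    refine (eLpNorm_sum_le (fun i _ => hm n i) hp1).trans (Finset.sum_le_sum fun i _ => ?_)
    exact (eLpNorm_norm (u (φ n) i - ⇑(w i))).le
  obtain ⟨ψ, hψ, hψlim⟩ := (tendstoInMeasure_of_tendsto_eLpNorm (one_pos.trans_le hp1).ne'
    (fun n => Finset.aestronglyMeasurable_fun_sum _ fun i _ => hm n i)
    aestronglyMeasurable_const hsum).exists_seq_tendsto_ae
  refine ⟨φ ∘ ψ, fun i => w i, hφ.comp hψ, fun i => Lp.memLp (w i),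
    fun i => (hLp i).comp hψ.tendsto_atTop, ?_⟩
  filter_upwards [hψlim] with x hx i
  refine tendsto_iff_norm_sub_tendsto_zero.2 (squeeze_zero (fun _ => norm_nonneg _)
    (fun k => ?_) hx)
  exact Finset.single_le_sum (f := fun i => |u (φ (ψ k)) i x - w i x|)
    (fun _ _ => abs_nonneg _) (Finset.mem_univ i)

/-! ### Passing to the limit in norms, pairings and total variation -/

section Limits

variable {α : Type*} [MeasurableSpace α] {μ : Measure α} {p : ℝ≥0∞}

lemma eLpNorm_eq_of_tendsto_eLpNorm_sub (hp1 : 1 ≤ p) {u : ℕ → α → ℝ} {w : α → ℝ}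
    (hu : ∀ n, MemLp (u n) p μ) (hw : MemLp w p μ)
    (hlim : Tendsto (fun n => eLpNorm (u n - w) p μ) atTop (𝓝 0)) {c : ℝ≥0∞}
    (hc : ∀ n, eLpNorm (u n) p μ = c) : eLpNorm w p μ = c := by
  refine le_antisymm ?_ ?_
  · have h1 : Tendsto (fun n => c + eLpNorm (u n - w) p μ) atTop (𝓝 (c + 0)) :=
      tendsto_const_nhds.add hlim
    rw [add_zero] at h1
    refine ge_of_tendsto' h1 fun n => ?_
    rw [← hc n]
    simpa using eLpNorm_sub_le (hu n).1 ((hu n).sub hw).1 hp1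
  · have h1 : Tendsto (fun n => eLpNorm w p μ + eLpNorm (u n - w) p μ) atTop
        (𝓝 (eLpNorm w p μ + 0)) := tendsto_const_nhds.add hlim
    rw [add_zero] at h1
    refine ge_of_tendsto' h1 fun n => ?_
    rw [← hc n]
    simpa using eLpNorm_add_le hw.1 ((hu n).sub hw).1 hp1

lemma tendsto_integral_mul_of_tendsto_eLpNorm_sub [TopologicalSpace α] [OpensMeasurableSpace α]
    [IsFiniteMeasureOnCompacts μ] (hp1 : 1 ≤ p) {u : ℕ → α → ℝ}
    {w : α → ℝ} (hu : ∀ n, MemLp (u n) p μ) (hw : MemLp w p μ)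
    (hlim : Tendsto (fun n => eLpNorm (u n - w) p μ) atTop (𝓝 0)) {ψ : α → ℝ}
    (hψ : Continuous ψ) (hψs : HasCompactSupport ψ) :
    Tendsto (fun n => ∫ x, u n x * ψ x ∂μ) atTop (𝓝 (∫ x, w x * ψ x ∂μ)) := by
  have := ENNReal.HolderConjugate.conjExponent hp1
  have hψq : MemLp ψ p.conjExponent μ := hψ.memLp_of_hasCompactSupport hψs
  refine tendsto_integral_of_L1' _ (hw.integrable_mul hψq).1
    (Eventually.of_forall fun n => (hu n).integrable_mul hψq) ?_
  have h1 : Tendsto (fun n => eLpNorm (u n - w) p μ * eLpNorm ψ p.conjExponent μ) atTop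
      (𝓝 (0 * eLpNorm ψ p.conjExponent μ)) :=
    ENNReal.Tendsto.mul_const hlim (Or.inr hψq.2.ne)
  rw [zero_mul] at h1
  refine tendsto_of_tendsto_of_tendsto_of_le_of_le tendsto_const_nhds h1 (fun _ => zero_le)
    fun n => ?_
  have h2 : (fun x => u n x * ψ x) - (fun x => w x * ψ x) = (u n - w) • ψ := by
    ext x
    simp [sub_mul]
  refine le_trans (le_of_eq ?_) (eLpNorm_smul_le_mul_eLpNorm (r := 1) hψq.1 ((hu n).sub hw).1)
  rw [← h2]
  rfl

end Limits

section TotalVariation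

variable {d : ℕ}

lemma totalVariation_congr_ae {u w : EuclideanSpace ℝ (Fin d) → ℝ} (h : u =ᵐ[volume] w) :
    totalVariation u = totalVariation w := by
  refine iSup_congr fun φ => ?_
  congr 1
  refine integral_congr_ae ?_
  filter_upwards [h] with x hx
  rw [hx]

lemma totalVariation_const_mul {c : ℝ} (hc : 0 ≤ c) (u : EuclideanSpace ℝ (Fin d) → ℝ) :
    totalVariation (fun x => c * u x) = ENNReal.ofReal c * totalVariation u := by
  simp only [totalVariation, mul_assoc, integral_const_mul, ENNReal.ofReal_mul hc,
    ENNReal.mul_iSup]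

lemma continuous_divergence {φ : EuclideanSpace ℝ (Fin d) → EuclideanSpace ℝ (Fin d)}
    (hφ : ContDiff ℝ 1 φ) : Continuous (divergence φ) := by
  refine continuous_finsetSum _ fun i _ => ?_
  exact (EuclideanSpace.proj (𝕜 := ℝ) i).continuous.comp
    ((hφ.continuous_fderiv one_ne_zero).clm_apply continuous_const)

lemma hasCompactSupport_divergence {φ : EuclideanSpace ℝ (Fin d) → EuclideanSpace ℝ (Fin d)}
    (hφ : HasCompactSupport φ) : HasCompactSupport (divergence φ) := by
  refine (hφ.fderiv (𝕜 := ℝ)).mono' ?_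
  intro x hx
  refine subset_tsupport _ fun h0 => hx ?_
  simp [divergence, h0]

/-- Lower semicontinuity of the total variation. -/
lemma totalVariation_le_of_tendsto {u : ℕ → EuclideanSpace ℝ (Fin d) → ℝ}
    {w : EuclideanSpace ℝ (Fin d) → ℝ} (hu : ∀ n, MemLp (u n) 1) (hw : MemLp w 1)
    (hlim : Tendsto (fun n => eLpNorm (u n - w) 1 volume) atTop (𝓝 0)) {a : ℕ → ℝ≥0∞} {v : ℝ≥0∞}
    (ha : ∀ n, totalVariation (u n) ≤ a n) (hav : Tendsto a atTop (𝓝 v)) :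
    totalVariation w ≤ v := by
  refine iSup_le fun φ => ?_
  refine le_of_tendsto_of_tendsto' (ENNReal.tendsto_ofReal
    (tendsto_integral_mul_of_tendsto_eLpNorm_sub le_rfl hu hw hlim
      (continuous_divergence φ.2.1) (hasCompactSupport_divergence φ.2.2.1))) hav fun n => ?_
  exact (le_iSup (fun φ : {φ : EuclideanSpace ℝ (Fin d) → EuclideanSpace ℝ (Fin d) //
      ContDiff ℝ 1 φ ∧ HasCompactSupport φ ∧ ∀ x, ‖φ x‖ ≤ 1} =>
    ENNReal.ofReal (∫ x, u n x * divergence φ.1 x)) φ).trans (ha n)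

end TotalVariation

/-! ### Compactness in `BV₀` and `W₀^{1,p}` -/

section Compactness

variable {d N : ℕ} {Ω : Set (EuclideanSpace ℝ (Fin d))}

lemma exists_common_bound {a : ℕ → Fin N → ℝ≥0∞} (ha : ∀ n i, a n i ≠ ⊤) {v : Fin N → ℝ≥0}
    (hav : ∀ i, Tendsto (fun n => a n i) atTop (𝓝 (v i : ℝ≥0∞))) :
    ∃ C : ℝ≥0, ∀ n i, a n i ≤ C := by
  choose C hC using fun i => exists_nnreal_bound_of_tendsto (fun n => ha n i) (hav i)
  refine ⟨∑ i, C i, fun n i => (hC i n).trans ?_⟩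
  exact_mod_cast Finset.single_le_sum (f := C) (fun _ _ => zero_le) (Finset.mem_univ i)

lemma ae_eq_zero_of_ae_tendsto {α ι : Type*} [MeasurableSpace α] {μ : Measure α} {F : Set α}
    {u : ℕ → ι → α → ℝ} {w : ι → α → ℝ} {φ : ℕ → ℕ} (hu : ∀ n i, ∀ᵐ x ∂μ, x ∉ F → u n i x = 0)
    (hlim : ∀ᵐ x ∂μ, ∀ i, Tendsto (fun n => u (φ n) i x) atTop (𝓝 (w i x))) (i : ι) :
    ∀ᵐ x ∂μ, x ∉ F → w i x = 0 := by
  filter_upwards [hlim, ae_all_iff.2 fun n => hu n i] with x hx h0 hxF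
  exact tendsto_nhds_unique (hx i) (tendsto_const_nhds.congr fun n => (h0 (φ n) hxF).symm)

/-- Compactness in `BV₀(Ω)` with lower semicontinuity of the total variation. -/
theorem exists_subseq_tendsto_of_memBVZero (hΩ : Bornology.IsBounded Ω)
    {u : ℕ → Fin N → EuclideanSpace ℝ (Fin d) → ℝ} (hu : ∀ n i, MemBVZero Ω (u n i))
    (hu1 : ∀ n i, eLpNorm (u n i) 1 volume = 1) {a : ℕ → Fin N → ℝ≥0∞} (ha : ∀ n i, a n i ≠ ⊤)
    (hua : ∀ n i, totalVariation (u n i) ≤ a n i) {v : Fin N → ℝ≥0}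
    (hav : ∀ i, Tendsto (fun n => a n i) atTop (𝓝 (v i : ℝ≥0∞))) :
    ∃ (φ : ℕ → ℕ) (w : Fin N → EuclideanSpace ℝ (Fin d) → ℝ), StrictMono φ ∧
      (∀ i, MemBVZero Ω (w i)) ∧ (∀ i, eLpNorm (w i) 1 volume = 1) ∧
      (∀ i, totalVariation (w i) ≤ v i) ∧
      ∀ᵐ x, ∀ i, Tendsto (fun n => u (φ n) i x) atTop (𝓝 (w i x)) := by
  obtain ⟨C, hC⟩ := exists_common_bound ha hav
  obtain ⟨R, hR⟩ := hΩ.subset_closedBall 0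
  have hLp : ∀ n i, MemLp (u n i) 1 := fun n i => memLp_one_iff_integrable.2 (hu n i).integrable
  obtain ⟨φ, w, hφ, hw, hlim, hae⟩ := exists_subseq_tendsto_eLpNorm (μ := volume) le_rfl
    ENNReal.one_ne_top hLp (M := 1) (C := C) (R := R) (fun n i => by simp [hu1 n i])
    (fun n i h => by
      refine (eLpNorm_translate_sub_le_totalVariation (hu n i).integrable
        (hu n i).totalVariation_lt_top.ne h).trans ?_
      rw [ENNReal.ofReal_mul ENNReal.toReal_nonneg, ofReal_norm,
        ENNReal.ofReal_toReal (hu n i).totalVariation_lt_top.ne]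
      gcongr
      exact (hua n i).trans (hC n i))
    (fun n i => (hu n i).eq_zero.mono fun x hx hxR => hx fun hxΩ => hxR (hR hxΩ))
  have htv : ∀ i, totalVariation (w i) ≤ v i := fun i =>
    totalVariation_le_of_tendsto (fun n => hLp (φ n) i) (hw i) (hlim i)
      (fun n => hua (φ n) i) ((hav i).comp hφ.tendsto_atTop)
  exact ⟨φ, w, hφ, fun i => ⟨memLp_one_iff_integrable.1 (hw i), (htv i).trans_lt ENNReal.coe_lt_top,
    ae_eq_zero_of_ae_tendsto (fun n i => (hu n i).eq_zero) hae i⟩,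
    fun i => eLpNorm_eq_of_tendsto_eLpNorm_sub le_rfl (fun n => hLp (φ n) i) (hw i) (hlim i)
      fun n => hu1 (φ n) i, htv, hae⟩

variable {p : ℝ}

lemma MemSobolevZero.integrable (hp : 1 < p) (hΩ : Bornology.IsBounded Ω)
    {u : EuclideanSpace ℝ (Fin d) → ℝ} {g : EuclideanSpace ℝ (Fin d) → EuclideanSpace ℝ (Fin d)}
    (h : MemSobolevZero p Ω u g) : Integrable u := by
  obtain ⟨R, hR⟩ := hΩ.subset_closedBall 0
  have hp1 : 1 ≤ ENNReal.ofReal p := ENNReal.one_le_ofReal.2 hp.le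
  refine IntegrableOn.integrable_of_ae_notMem_eq_zero
    (s := Metric.closedBall (0 : EuclideanSpace ℝ (Fin d)) R) ?_
    (h.eq_zero.mono fun x hx hxR => hx fun hxΩ => hxR (hR hxΩ))
  have : IsFiniteMeasure (volume.restrict (Metric.closedBall (0 : EuclideanSpace ℝ (Fin d)) R)) :=
    ⟨by rw [Measure.restrict_apply_univ]; exact measure_closedBall_lt_top⟩
  exact (h.memLp.restrict _).integrable hp1

lemma MemSobolevZero.grad_ae_eq_zero (hp : 1 < p) (hΩ : Bornology.IsBounded Ω)
    {u : EuclideanSpace ℝ (Fin d) → ℝ} {g : EuclideanSpace ℝ (Fin d) → EuclideanSpace ℝ (Fin d)}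
    (h : MemSobolevZero p Ω u g) : ∀ᵐ x, u x = 0 → g x = 0 := by
  refine h.isWeakGradient.ae_eq_zero (ENNReal.one_le_ofReal.2 hp.le) ENNReal.ofReal_ne_top
    (h.integrable hp hΩ) (ne_top_of_le_ne_top hΩ.measure_lt_top.ne (measure_mono_ae ?_))
    h.memLp_grad
  filter_upwards [h.eq_zero] with x hx hux
  by_contra hxΩ
  exact hux (hx hxΩ)

/-- Limits of Sobolev functions with bounded gradients are Sobolev functions, and the norm of the
gradient is lower semicontinuous. -/
lemma exists_isWeakGradient_of_tendsto (hp : 1 < p) (hΩ : Bornology.IsBounded Ω)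
    {u : ℕ → EuclideanSpace ℝ (Fin d) → ℝ}
    {g : ℕ → EuclideanSpace ℝ (Fin d) → EuclideanSpace ℝ (Fin d)}
    (hu : ∀ n, MemSobolevZero p Ω (u n) (g n)) {w : EuclideanSpace ℝ (Fin d) → ℝ}
    (hw : MemLp w (ENNReal.ofReal p))
    (hlim : Tendsto (fun n => eLpNorm (u n - w) (ENNReal.ofReal p) volume) atTop (𝓝 0))
    {a : ℕ → ℝ≥0∞} (ha : ∀ n, a n ≠ ⊤) (hga : ∀ n, ∫⁻ x, ‖g n x‖ₑ ^ p ≤ a n) {v : ℝ≥0}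
    (hav : Tendsto a atTop (𝓝 v)) :
    ∃ G, IsWeakGradient w G ∧ MemLp G (ENNReal.ofReal p) ∧ ∫⁻ x, ‖G x‖ₑ ^ p ≤ v := by
  have hp1 : 1 ≤ ENNReal.ofReal p := ENNReal.one_le_ofReal.2 hp.le
  have hp0 : 0 < p := one_pos.trans hp
  obtain ⟨R, hR⟩ := hΩ.subset_closedBall 0
  set D := Metric.closedBall (0 : EuclideanSpace ℝ (Fin d)) R with hD
  have hDm : MeasurableSet D := Metric.isClosed_closedBall.measurableSet
  have : IsFiniteMeasure (volume.restrict D) :=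
    ⟨by rw [Measure.restrict_apply_univ]; exact measure_closedBall_lt_top⟩
  -- The gradients live on the ball `D`. Weak limits can thus be taken on a finite measure space,
  -- and the zero extension of the limit is a weak gradient on the whole space.
  have hgD : ∀ n, ∀ᵐ x, x ∉ D → g n x = 0 := by
    intro n
    filter_upwards [(hu n).eq_zero, (hu n).grad_ae_eq_zero hp hΩ] with x h1 h2 hxD
    exact h2 (h1 fun hxΩ => hxD (hR hxΩ))
  obtain ⟨G, hG, hGv, hGlim⟩ := exists_weak_limit_vector hp
    (fun n => (hu n).memLp_grad.restrict D) ha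
    (fun n => (setLIntegral_le_lintegral D _).trans (hga n)) hav
  have hG' : MemLp (D.indicator G) (ENNReal.ofReal p) := (memLp_indicator_iff_restrict hDm).2 hG
  refine ⟨D.indicator G, ⟨hw.locallyIntegrable hp1, hG'.locallyIntegrable hp1, ?_⟩, hG', ?_⟩
  · intro η hη hηs i
    obtain ⟨c, hc⟩ := hηs.exists_bound_of_continuous hη.continuous
    have h1 : Tendsto (fun n => ∫ x, u n x * fderiv ℝ η x (EuclideanSpace.single i 1))
        (hyperfilter ℕ) (𝓝 (∫ x, w x * fderiv ℝ η x (EuclideanSpace.single i 1))) :=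
      (tendsto_integral_mul_of_tendsto_eLpNorm_sub hp1 (fun n => (hu n).memLp) hw hlim
        ((hη.continuous_fderiv (by simp)).clm_apply continuous_const)
        (hηs.fderiv_apply (𝕜 := ℝ) _)).mono_left Nat.hyperfilter_le_atTop
    have h2 := (hGlim η hη.continuous.measurable c hc i).neg
    have h3 : ∀ H : EuclideanSpace ℝ (Fin d) → EuclideanSpace ℝ (Fin d),
        (∀ᵐ x, x ∉ D → H x = 0) → ∫ x, H x i * η x = ∫ x in D, η x * H x i := by
      intro H hH
      rw [← integral_indicator hDm]
      refine integral_congr_ae ?_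
      filter_upwards [hH] with x hx
      by_cases hxD : x ∈ D
      · rw [Set.indicator_of_mem hxD, mul_comm]
      · rw [Set.indicator_of_notMem hxD, hx hxD, PiLp.zero_apply, zero_mul]
    have h4 : ∫ x, (D.indicator G) x i * η x = ∫ x in D, η x * G x i := by
      rw [h3 _ (ae_of_all _ fun x hx => Set.indicator_of_notMem hx G)]
      refine setIntegral_congr_fun hDm fun x hx => ?_
      simp only [Set.indicator_of_mem hx]
    rw [h4]
    refine tendsto_nhds_unique h1 (h2.congr fun n => ?_)
    rw [(hu n).isWeakGradient.integral_eq η hη hηs i, h3 _ (hgD n)]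
  · rw [← lintegral_indicator hDm] at hGv
    refine le_trans (le_of_eq (lintegral_congr fun x => ?_)) hGv
    by_cases hxD : x ∈ D
    · simp only [Set.indicator_of_mem hxD]
    · simp only [Set.indicator_of_notMem hxD, enorm_zero, ENNReal.zero_rpow_of_pos hp0]

/-- Compactness in `W₀^{1,p}(Ω)` with lower semicontinuity of the norm of the gradient. -/
theorem exists_subseq_tendsto_of_memSobolevZero (hp : 1 < p) (hΩ : Bornology.IsBounded Ω)
    {u : ℕ → Fin N → EuclideanSpace ℝ (Fin d) → ℝ}
    {g : ℕ → Fin N → EuclideanSpace ℝ (Fin d) → EuclideanSpace ℝ (Fin d)}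
    (hu : ∀ n i, MemSobolevZero p Ω (u n i) (g n i))
    (hu1 : ∀ n i, eLpNorm (u n i) (ENNReal.ofReal p) volume = 1)
    {a : ℕ → Fin N → ℝ≥0∞} (ha : ∀ n i, a n i ≠ ⊤)
    (hga : ∀ n i, ∫⁻ x, ‖g n i x‖ₑ ^ p ≤ a n i) {v : Fin N → ℝ≥0}
    (hav : ∀ i, Tendsto (fun n => a n i) atTop (𝓝 (v i : ℝ≥0∞))) :
    ∃ (φ : ℕ → ℕ) (w : Fin N → EuclideanSpace ℝ (Fin d) → ℝ)
      (G : Fin N → EuclideanSpace ℝ (Fin d) → EuclideanSpace ℝ (Fin d)), StrictMono φ ∧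
      (∀ i, MemSobolevZero p Ω (w i) (G i)) ∧
      (∀ i, eLpNorm (w i) (ENNReal.ofReal p) volume = 1) ∧
      (∀ i, ∫⁻ x, ‖G i x‖ₑ ^ p ≤ v i) ∧
      ∀ᵐ x, ∀ i, Tendsto (fun n => u (φ n) i x) atTop (𝓝 (w i x)) := by
  have hp1 : 1 ≤ ENNReal.ofReal p := ENNReal.one_le_ofReal.2 hp.le
  have hp0 : 0 < p := one_pos.trans hp
  obtain ⟨C, hC⟩ := exists_common_bound ha hav
  obtain ⟨R, hR⟩ := hΩ.subset_closedBall 0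
  obtain ⟨φ, w, hφ, hw, hlim, hae⟩ := exists_subseq_tendsto_eLpNorm (μ := volume) hp1
    ENNReal.ofReal_ne_top (fun n i => (hu n i).memLp) (M := 1) (C := C ^ p⁻¹) (R := R)
    (fun n i => by simp [hu1 n i])
    (fun n i h => by
      refine ((hu n i).isWeakGradient.eLpNorm_translate_sub_le hp1 ENNReal.ofReal_ne_top
        ((hu n i).integrable hp hΩ) (hu n i).memLp_grad h).trans ?_
      rw [ofReal_norm, mul_comm]
      gcongr
      rw [← ENNReal.rpow_le_rpow_iff hp0, eLpNorm_ofReal_rpow hp0,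
        ← ENNReal.coe_rpow_of_nonneg _ hp0.le, NNReal.rpow_inv_rpow hp0.ne']
      exact (hga n i).trans (hC n i))
    (fun n i => (hu n i).eq_zero.mono fun x hx hxR => hx fun hxΩ => hxR (hR hxΩ))
  choose G hG hGp hGv using fun i => exists_isWeakGradient_of_tendsto hp hΩ
    (fun n => hu (φ n) i) (hw i) (hlim i) (fun n => ha (φ n) i) (fun n => hga (φ n) i)
    ((hav i).comp hφ.tendsto_atTop)
  exact ⟨φ, w, G, hφ, fun i => ⟨hw i, hGp i, hG i,
    ae_eq_zero_of_ae_tendsto (fun n i => (hu n i).eq_zero) hae i⟩,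
    fun i => eLpNorm_eq_of_tendsto_eLpNorm_sub hp1 (fun n => (hu (φ n) i).memLp) (hw i) (hlim i)
      fun n => hu1 (φ n) i, hGv, hae⟩

end Compactness

/-! ### Compactness for `N`-clusters and `N`-sets -/

variable {d N : ℕ} {Ω : Set (EuclideanSpace ℝ (Fin d))}

lemma IsNSet.volume_ne_top (hΩ : Bornology.IsBounded Ω)
    {E : Fin N → Set (EuclideanSpace ℝ (Fin d))} (hE : IsNSet Ω E) (i : Fin N) :
    volume (E i) ≠ ⊤ :=
  ne_top_of_le_ne_top hΩ.measure_lt_top.ne (measure_mono_ae (ae_le_set.2 (hE.subset i)))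

/-- Shrinking the chambers of an `N`-set gives an `N`-set. -/
lemma IsNSet.mono {E F : Fin N → Set (EuclideanSpace ℝ (Fin d))} (hE : IsNSet Ω E)
    (hm : ∀ i, NullMeasurableSet (F i)) (hsub : ∀ i, volume (F i \ E i) = 0)
    (hpos : ∀ i, 0 < volume (F i)) : IsNSet Ω F := by
  have hae : ∀ i, F i ≤ᵐ[volume] E i := fun i => ae_le_set.2 (hsub i)
  refine ⟨hm, fun i => ?_, hpos, fun i j hij => ?_⟩
  · exact ae_le_set.1 ((hae i).trans (ae_le_set.2 (hE.subset i)))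
  · exact measure_mono_null_ae ((hae i).inter (hae j)) (hE.disjoint i j hij)

lemma totalVariation_indicator_const {c : ℝ} (hc : 0 ≤ c) (E : Set (EuclideanSpace ℝ (Fin d))) :
    totalVariation (E.indicator fun _ => c) = ENNReal.ofReal c * perimeter E := by
  rw [perimeter, ← totalVariation_const_mul hc]
  congr 1
  ext x
  by_cases hx : x ∈ E <;> simp [hx]

/-- This turns the Cheeger ratio of a set into the energy of an `L¹`-normalised function, so that
compactness in `BV₀` applies to clusters. -/
lemma totalVariation_normalized_indicator {E : Set (EuclideanSpace ℝ (Fin d))}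
    (h0 : 0 < volume E) (h1 : volume E ≠ ⊤) :
    totalVariation (E.indicator fun _ => (volume E).toReal⁻¹) = perimeter E / volume E := by
  rw [totalVariation_indicator_const (by positivity),
    ENNReal.ofReal_inv_of_pos (ENNReal.toReal_pos h0.ne' h1), ENNReal.ofReal_toReal h1, mul_comm,
    div_eq_mul_inv]

lemma eLpNorm_indicator_const_one {E : Set (EuclideanSpace ℝ (Fin d))} (hE : NullMeasurableSet E)
    {c : ℝ} (hc : 0 ≤ c) :
    eLpNorm (E.indicator fun _ => c) 1 volume = ENNReal.ofReal c * volume E := by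
  rw [eLpNorm_indicator_const₀ hE one_ne_zero ENNReal.one_ne_top, Real.enorm_eq_ofReal hc]
  simp

lemma nullMeasurableSet_ne_zero {α : Type*} [MeasurableSpace α] {μ : Measure α} {w : α → ℝ}
    (hw : AEMeasurable w μ) : NullMeasurableSet {x | w x ≠ 0} μ :=
  (hw.nullMeasurable (measurableSet_singleton 0)).compl

lemma measure_ne_zero_pos_of_eLpNorm {α : Type*} [MeasurableSpace α] {μ : Measure α} {p : ℝ≥0∞}
    {w : α → ℝ} (hw : eLpNorm w p μ = 1) : 0 < μ {x | w x ≠ 0} := by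
  refine pos_iff_ne_zero.2 fun h0 => ?_
  have : w =ᵐ[μ] 0 := measure_eq_zero_iff_ae_notMem.1 h0 |>.mono fun x hx => not_not.1 hx
  rw [eLpNorm_congr_ae this, eLpNorm_zero] at hw
  exact zero_ne_one hw

/-- Compactness of `N`-clusters with bounded Cheeger ratios. -/
theorem exists_isNCluster_perimeter_div_volume_le (hΩ : Bornology.IsBounded Ω)
    {E : ℕ → Fin N → Set (EuclideanSpace ℝ (Fin d))} (hE : ∀ n, IsNSet Ω (E n))
    {a : ℕ → Fin N → ℝ≥0∞} (ha : ∀ n i, a n i ≠ ⊤)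
    (hEa : ∀ n i, perimeter (E n i) / volume (E n i) ≤ a n i) {v : Fin N → ℝ≥0}
    (hav : ∀ i, Tendsto (fun n => a n i) atTop (𝓝 (v i : ℝ≥0∞))) :
    ∃ F : Fin N → Set (EuclideanSpace ℝ (Fin d)), IsNCluster Ω F ∧
      ∀ i, perimeter (F i) / volume (F i) ≤ v i := by
  have hEtop := fun n i => (hE n).volume_ne_top hΩ i
  have hEpos := fun n i => (hE n).pos i
  have hErpos : ∀ n i, 0 < (volume (E n i)).toReal := fun n i =>
    ENNReal.toReal_pos (hEpos n i).ne' (hEtop n i)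
  set u : ℕ → Fin N → EuclideanSpace ℝ (Fin d) → ℝ := fun n i =>
    (E n i).indicator fun _ => (volume (E n i)).toReal⁻¹ with hu
  have humem : ∀ n i x, u n i x ≠ 0 → x ∈ E n i := fun n i x hx =>
    Set.mem_of_indicator_ne_zero hx
  have huval : ∀ n i x, x ∈ E n i → u n i x = (volume (E n i)).toReal⁻¹ := fun n i x hx =>
    Set.indicator_of_mem hx _
  have hua : ∀ n i, totalVariation (u n i) ≤ a n i := fun n i =>
    (totalVariation_normalized_indicator (hEpos n i) (hEtop n i)).trans_le (hEa n i)
  have huBV : ∀ n i, MemBVZero Ω (u n i) := by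
    refine fun n i => ⟨?_, (hua n i).trans_lt (ha n i).lt_top, ?_⟩
    · exact (integrableOn_const (hEtop n i)).integrable_indicator₀ ((hE n).nullMeasurableSet i)
    · filter_upwards [measure_eq_zero_iff_ae_notMem.1 ((hE n).subset i)] with x hx hxΩ
      by_contra hne
      exact hx ⟨humem n i x hne, hxΩ⟩
  have hu1 : ∀ n i, eLpNorm (u n i) 1 volume = 1 := by
    intro n i
    rw [hu, eLpNorm_indicator_const_one ((hE n).nullMeasurableSet i) (by positivity),
      ENNReal.ofReal_inv_of_pos (hErpos n i), ENNReal.ofReal_toReal (hEtop n i),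
      ENNReal.inv_mul_cancel (hEpos n i).ne' (hEtop n i)]
  obtain ⟨φ, w, -, hw, hw1, hwv, hae⟩ :=
    exists_subseq_tendsto_of_memBVZero hΩ huBV hu1 ha hua hav
  set F : Fin N → Set (EuclideanSpace ℝ (Fin d)) := fun i => {x | w i x ≠ 0} with hF
  -- A nonzero limit forces nonzero values for large `n`; hence inclusion and disjointness pass to
  -- the limit.
  have hev : ∀ᵐ x, ∀ i, x ∈ F i → ∀ᶠ n in atTop, x ∈ E (φ n) i := by
    filter_upwards [hae] with x hx i hxF
    filter_upwards [(hx i).eventually_ne hxF] with n hn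
    exact humem _ _ _ hn
  have hFset : IsNSet Ω F := by
    refine ⟨fun i => nullMeasurableSet_ne_zero (hw i).integrable.1.aemeasurable, fun i => ?_,
      fun i => measure_ne_zero_pos_of_eLpNorm (hw1 i), fun i j hij => ?_⟩
    · refine measure_eq_zero_iff_ae_notMem.2 ((hw i).eq_zero.mono fun x hx hxF => ?_)
      exact hxF.1 (hx hxF.2)
    · refine measure_eq_zero_iff_ae_notMem.2 ?_
      filter_upwards [hev, ae_all_iff.2 fun n =>
        measure_eq_zero_iff_ae_notMem.1 ((hE (φ n)).disjoint i j hij)] with x hx hdis hxF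
      obtain ⟨n, hn⟩ := ((hx i hxF.1).and (hx j hxF.2)).exists
      exact hdis n hn
  have hFtop := fun i => hFset.volume_ne_top hΩ i
  have hratio : ∀ i, perimeter (F i) / volume (F i) ≤ v i := by
    intro i
    -- A reference point in `F i`: for a.e. point of `F i`, both values of `u (φ n) i` eventually
    -- equal the same inverse volume. So `w i` is a constant `c` on `F i`, and the normalisation
    -- gives `c = 1 / |F i|`.
    obtain ⟨x₀, hx₀, hx₀F, hx₀E⟩ : ∃ x, (∀ i, Tendsto (fun n => u (φ n) i x) atTop (𝓝 (w i x))) ∧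
        x ∈ F i ∧ ∀ᶠ n in atTop, x ∈ E (φ n) i := by
      have hfr : ∃ᵐ x ∂(volume : Measure (EuclideanSpace ℝ (Fin d))), x ∈ F i :=
        frequently_ae_mem_iff.2 (hFset.pos i).ne'
      obtain ⟨x, hxF, hx1, hx2⟩ := (hfr.and_eventually (hae.and hev)).exists
      exact ⟨x, hx1, hxF, hx2 i hxF⟩
    set c := w i x₀ with hc
    have hc0 : 0 ≤ c := ge_of_tendsto' (hx₀ i) fun n =>
      Set.indicator_nonneg (fun _ _ => by positivity) _
    have hwc : w i =ᵐ[volume] (F i).indicator fun _ => c := by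
      filter_upwards [hae, hev] with x hx hxE
      by_cases hxF : x ∈ F i
      · rw [Set.indicator_of_mem hxF]
        refine tendsto_nhds_unique (hx i) ((hx₀ i).congr' ?_)
        filter_upwards [hxE i hxF, hx₀E] with n hn hn0
        rw [huval _ _ _ hn, huval _ _ _ hn0]
      · rw [Set.indicator_of_notMem hxF]
        exact not_not.1 hxF
    have hcF : ENNReal.ofReal c * volume (F i) = 1 := by
      rw [← eLpNorm_indicator_const_one (hFset.nullMeasurableSet i) hc0, ← eLpNorm_congr_ae hwc,
        hw1 i]
    rw [div_eq_mul_inv, ← ENNReal.eq_inv_of_mul_eq_one_left hcF, mul_comm,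
      ← totalVariation_indicator_const hc0, ← totalVariation_congr_ae hwc]
    exact hwv i
  refine ⟨F, ⟨hFset, fun i => ?_⟩, hratio⟩
  by_contra htop
  have h1 := hratio i
  rw [not_lt_top_iff.1 htop, ENNReal.top_div_of_ne_top (hFtop i)] at h1
  exact ENNReal.coe_ne_top (top_le_iff.1 h1)

/-- The inner infima need not be attained. A slack `1 / (n + 1)`, finite also at `n = 0`, allows
almost optimal choices without changing the limits. -/
lemma tendsto_add_inv_succ {a : ℕ → ℝ≥0∞} {v : ℝ≥0∞} (h : Tendsto a atTop (𝓝 v)) :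
    Tendsto (fun n => a n + ((n + 1 : ℕ) : ℝ≥0∞)⁻¹) atTop (𝓝 v) := by
  have h1 := h.add (ENNReal.tendsto_inv_nat_nhds_zero.comp (tendsto_add_atTop_nat 1))
  rwa [add_zero] at h1

lemma lt_add_inv_succ {x : ℝ≥0∞} (hx : x ≠ ⊤) (n : ℕ) : x < x + ((n + 1 : ℕ) : ℝ≥0∞)⁻¹ :=
  ENNReal.lt_add_right hx (ENNReal.inv_ne_zero.2 (ENNReal.natCast_ne_top _))

lemma add_inv_succ_ne_top {x : ℝ≥0∞} (hx : x ≠ ⊤) (n : ℕ) :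
    x + ((n + 1 : ℕ) : ℝ≥0∞)⁻¹ ≠ ⊤ :=
  ENNReal.add_ne_top.2 ⟨hx, ENNReal.inv_ne_top.2 (by simp)⟩

lemma cheegerConstant_le {E F : Set (EuclideanSpace ℝ (Fin d))} (hE : NullMeasurableSet E)
    (hEF : volume (E \ F) = 0) (hpos : 0 < volume E) :
    cheegerConstant F ≤ perimeter E / volume E :=
  iInf_le_of_le ⟨E, hE, hEF, hpos⟩ le_rfl

lemma firstEigenvalue_le {p : ℝ} {F : Set (EuclideanSpace ℝ (Fin d))}
    {u : EuclideanSpace ℝ (Fin d) → ℝ} {g : EuclideanSpace ℝ (Fin d) → EuclideanSpace ℝ (Fin d)}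
    (h : MemSobolevZero p F u g) (h1 : eLpNorm u (ENNReal.ofReal p) volume = 1) :
    firstEigenvalue p F ≤ ∫⁻ x in F, ‖g x‖ₑ ^ p :=
  iInf_le_of_le ⟨(u, g), h, h1⟩ le_rfl

/-- Limits of the vectors of Cheeger constants of `N`-sets. -/
theorem exists_isNSet_cheegerConstant_le (hΩ : Bornology.IsBounded Ω)
    {E : ℕ → Fin N → Set (EuclideanSpace ℝ (Fin d))} (hE : ∀ n, IsNSet Ω (E n))
    (hfin : ∀ n i, cheegerConstant (E n i) ≠ ⊤) {v : Fin N → ℝ≥0}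
    (hv : ∀ i, Tendsto (fun n => cheegerConstant (E n i)) atTop (𝓝 (v i : ℝ≥0∞))) :
    ∃ F : Fin N → Set (EuclideanSpace ℝ (Fin d)), IsNSet Ω F ∧
      ∀ i, cheegerConstant (F i) ≤ v i := by
  -- Almost optimal subsets of the chambers still form `N`-sets, and each limit chamber competes in
  -- its own Cheeger constant.
  choose G hG using fun n i => iInf_lt_iff.1 (lt_add_inv_succ (hfin n i) n)
  obtain ⟨F, hF, hFv⟩ := exists_isNCluster_perimeter_div_volume_le hΩ
    (E := fun n i => (G n i).1) (fun n => (hE n).mono (fun i => (G n i).2.1)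
      (fun i => (G n i).2.2.1) (fun i => (G n i).2.2.2))
    (fun n i => add_inv_succ_ne_top (hfin n i) n) (fun n i => (hG n i).le)
    (fun i => tendsto_add_inv_succ (hv i))
  refine ⟨F, hF.toIsNSet, fun i => (cheegerConstant_le (hF.nullMeasurableSet i) ?_
    (hF.pos i)).trans (hFv i)⟩
  rw [Set.sdiff_self, measure_empty]

/-- The energy on a set outside of which the function vanishes is the total energy. -/
lemma MemSobolevZero.setLIntegral_grad_eq {p : ℝ} (hp : 1 < p) (hΩ : Bornology.IsBounded Ω)
    {F : Set (EuclideanSpace ℝ (Fin d))} (hF : NullMeasurableSet F)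
    {u : EuclideanSpace ℝ (Fin d) → ℝ} {g : EuclideanSpace ℝ (Fin d) → EuclideanSpace ℝ (Fin d)}
    (h : MemSobolevZero p Ω u g) (hu : ∀ᵐ x, x ∉ F → u x = 0) :
    ∫⁻ x in F, ‖g x‖ₑ ^ p = ∫⁻ x, ‖g x‖ₑ ^ p := by
  rw [← lintegral_indicator₀ hF]
  refine lintegral_congr_ae ?_
  filter_upwards [hu, h.grad_ae_eq_zero hp hΩ] with x h1 h2
  by_cases hxF : x ∈ F
  · rw [Set.indicator_of_mem hxF]
  · rw [Set.indicator_of_notMem hxF, h2 (h1 hxF), enorm_zero,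
      ENNReal.zero_rpow_of_pos (one_pos.trans hp)]

/-- Limits of the vectors of first eigenvalues of `N`-sets. -/
theorem exists_isNSet_firstEigenvalue_le {p : ℝ} (hp : 1 < p) (hΩ : Bornology.IsBounded Ω)
    {E : ℕ → Fin N → Set (EuclideanSpace ℝ (Fin d))} (hE : ∀ n, IsNSet Ω (E n))
    (hfin : ∀ n i, firstEigenvalue p (E n i) ≠ ⊤) {v : Fin N → ℝ≥0}
    (hv : ∀ i, Tendsto (fun n => firstEigenvalue p (E n i)) atTop (𝓝 (v i : ℝ≥0∞))) :
    ∃ F : Fin N → Set (EuclideanSpace ℝ (Fin d)), IsNSet Ω F ∧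
      ∀ i, firstEigenvalue p (F i) ≤ v i := by
  choose z hz using fun n i => iInf_lt_iff.1 (lt_add_inv_succ (hfin n i) n)
  have hzE : ∀ n i, ∀ᵐ x, x ∉ E n i → (z n i).1.1 x = 0 := fun n i => (z n i).2.1.eq_zero
  have hzΩ : ∀ n i, MemSobolevZero p Ω (z n i).1.1 (z n i).1.2 := by
    intro n i
    obtain ⟨⟨h1, h2, h3, h4⟩, -⟩ := (z n i).2
    refine ⟨h1, h2, h3, ?_⟩
    filter_upwards [h4, measure_eq_zero_iff_ae_notMem.1 ((hE n).subset i)] with x hx hxE hxΩ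
    exact hx fun hxm => hxE ⟨hxm, hxΩ⟩
  -- The eigenvalue integrates over the chamber only; this is the whole energy, because the gradient
  -- vanishes a.e. where the function does.
  obtain ⟨φ, w, g, -, hw, hw1, hwv, hae⟩ := exists_subseq_tendsto_of_memSobolevZero hp hΩ hzΩ
    (fun n i => (z n i).2.2) (fun n i => add_inv_succ_ne_top (hfin n i) n)
    (fun n i => (((hzΩ n i).setLIntegral_grad_eq hp hΩ ((hE n).nullMeasurableSet i)
      (hzE n i)).symm.trans_lt (hz n i)).le) (fun i => tendsto_add_inv_succ (hv i))
  refine ⟨fun i => {x | w i x ≠ 0}, ⟨fun i =>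
    nullMeasurableSet_ne_zero (hw i).memLp.1.aemeasurable, fun i => ?_,
    fun i => measure_ne_zero_pos_of_eLpNorm (hw1 i), fun i j hij => ?_⟩, fun i => ?_⟩
  · refine measure_eq_zero_iff_ae_notMem.2 ((hw i).eq_zero.mono fun x hx hxF => ?_)
    exact hxF.1 (hx hxF.2)
  · refine measure_eq_zero_iff_ae_notMem.2 ?_
    filter_upwards [hae, ae_all_iff.2 fun n => hzE n i, ae_all_iff.2 fun n => hzE n j,
      ae_all_iff.2 fun n => measure_eq_zero_iff_ae_notMem.1 ((hE n).disjoint i j hij)]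
      with x hx hi hj hdis hxF
    obtain ⟨n, hni, hnj⟩ := (((hx i).eventually_ne hxF.1).and
      ((hx j).eventually_ne hxF.2)).exists
    exact hdis (φ n) ⟨not_not.1 fun h => hni (hi _ h), not_not.1 fun h => hnj (hj _ h)⟩
  -- By construction `w i` vanishes off the new chamber, so it is admissible for its eigenvalue.
  · refine (firstEigenvalue_le (u := w i) (g := g i) ⟨(hw i).memLp, (hw i).memLp_grad,
      (hw i).isWeakGradient, ae_of_all _ fun x hx => not_not.1 hx⟩ (hw1 i)).trans ?_
    exact (setLIntegral_le_lintegral _ _).trans (hwv i)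

/-- Sign and disjointness are closed pointwise conditions. The norm can drop under a.e. convergence,
so it is a separate hypothesis, supplied by strong convergence. -/
lemma IsNormalizedDisjoint.of_ae_tendsto {p : ℝ}
    {u : ℕ → Fin N → EuclideanSpace ℝ (Fin d) → ℝ} {w : Fin N → EuclideanSpace ℝ (Fin d) → ℝ}
    {φ : ℕ → ℕ} (hu : ∀ n, IsNormalizedDisjoint p Ω (u n))
    (hw1 : ∀ i, eLpNorm (w i) (ENNReal.ofReal p) volume = 1)
    (hae : ∀ᵐ x, ∀ i, Tendsto (fun n => u (φ n) i x) atTop (𝓝 (w i x))) :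
    IsNormalizedDisjoint p Ω w := by
  refine ⟨fun i => ?_, hw1, fun i j hij => ?_⟩
  · filter_upwards [hae, ae_all_iff.2 fun n => (hu n).nonneg i] with x hx h0
    exact ge_of_tendsto' (hx i) fun n => h0 _
  · filter_upwards [hae, ae_all_iff.2 fun n => (hu n).mul_eq_zero i j hij] with x hx h0 hxΩ
    exact tendsto_nhds_unique ((hx i).mul (hx j))
      (tendsto_const_nhds.congr fun n => (h0 (φ n) hxΩ).symm)

/-! ### The three limits -/

section Stability

variable {Φk : ℕ → (Fin N → ℝ≥0) → ℝ≥0} {Φ : (Fin N → ℝ≥0) → ℝ≥0}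

theorem tendsto_cheegerN (hΩ : Bornology.IsBounded Ω) (h_equi : Equicoercive Φk)
    (h_ptw : ∀ v, Tendsto (fun k => Φk k v) atTop (𝓝 (Φ v))) (h_gamma : GammaTendsto Φk Φ)
    (h_incr : Monotone Φ) :
    Tendsto (fun k => cheegerN (Φk k) Ω) atTop (𝓝 (cheegerN Φ Ω)) := by
  refine tendsto_iInf_evalExt (fun (E : {E : Fin N → Set (EuclideanSpace ℝ (Fin d)) //
    IsNCluster Ω E}) i => perimeter (E.1 i) / volume (E.1 i)) h_equi h_ptw h_gamma h_incr
    fun E v hfin hlim => ?_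
  obtain ⟨F, hF, hFv⟩ := exists_isNCluster_perimeter_div_volume_le hΩ
    (E := fun n => (E n).1) (fun n => (E n).2.toIsNSet) hfin (fun _ _ => le_rfl) hlim
  exact ⟨⟨F, hF⟩, hFv⟩

theorem tendsto_functionalEigenvalue (hΩ : Bornology.IsBounded Ω) (h_equi : Equicoercive Φk)
    (h_ptw : ∀ v, Tendsto (fun k => Φk k v) atTop (𝓝 (Φ v))) (h_gamma : GammaTendsto Φk Φ)
    (h_incr : Monotone Φ) {p : ℝ} (hp : 1 ≤ p) :
    Tendsto (fun k => functionalEigenvalue (Φk k) p Ω) atTop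
      (𝓝 (functionalEigenvalue Φ p Ω)) := by
  classical
  rcases hp.eq_or_lt with rfl | hp
  · simp only [functionalEigenvalue, if_true]
    refine tendsto_iInf_evalExt (fun (u : {u : Fin N → EuclideanSpace ℝ (Fin d) → ℝ //
      IsOneNFunction Ω u}) i => totalVariation (u.1 i)) h_equi h_ptw h_gamma h_incr
      fun u v hfin hlim => ?_
    obtain ⟨φ, w, -, hw, hw1, hwv, hae⟩ := exists_subseq_tendsto_of_memBVZero hΩ
      (u := fun n => (u n).1) (fun n i => (u n).2.mem i)
      (fun n i => by simpa using (u n).2.norm_eq_one i) hfin (fun _ _ => le_rfl) hlim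
    exact ⟨⟨w, IsNormalizedDisjoint.of_ae_tendsto (fun n => (u n).2.toIsNormalizedDisjoint)
      (fun i => by simpa using hw1 i) hae, hw⟩, hwv⟩
  · simp only [functionalEigenvalue, if_neg hp.ne']
    refine tendsto_iInf_evalExt (fun (w : {w : (Fin N → EuclideanSpace ℝ (Fin d) → ℝ) ×
      (Fin N → EuclideanSpace ℝ (Fin d) → EuclideanSpace ℝ (Fin d)) //
        IsPNFunction p Ω w.1 w.2}) i => ∫⁻ x, ‖w.1.2 i x‖ₑ ^ p) h_equi h_ptw h_gamma h_incr
      fun u v hfin hlim => ?_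
    obtain ⟨φ, w, g, -, hw, hw1, hwv, hae⟩ := exists_subseq_tendsto_of_memSobolevZero hp hΩ
      (u := fun n => (u n).1.1) (g := fun n => (u n).1.2) (fun n i => (u n).2.mem i)
      (fun n i => (u n).2.norm_eq_one i) hfin (fun _ _ => le_rfl) hlim
    exact ⟨⟨(w, g), IsNormalizedDisjoint.of_ae_tendsto
      (fun n => (u n).2.toIsNormalizedDisjoint) hw1 hae, hw⟩, hwv⟩

/-- The constants of the limit chambers may lie strictly below the limit vector; an upper bound
suffices because `Φ` is increasing. -/
theorem tendsto_geometricEigenvalue (hΩ : Bornology.IsBounded Ω) (h_equi : Equicoercive Φk)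
    (h_ptw : ∀ v, Tendsto (fun k => Φk k v) atTop (𝓝 (Φ v))) (h_gamma : GammaTendsto Φk Φ)
    (h_incr : Monotone Φ) {p : ℝ} (hp : 1 ≤ p) :
    Tendsto (fun k => geometricEigenvalue (Φk k) p Ω) atTop
      (𝓝 (geometricEigenvalue Φ p Ω)) := by
  classical
  rcases hp.eq_or_lt with rfl | hp
  · simp only [geometricEigenvalue, if_true]
    refine tendsto_iInf_evalExt (fun (E : {E : Fin N → Set (EuclideanSpace ℝ (Fin d)) //
      IsNSet Ω E}) i => cheegerConstant (E.1 i)) h_equi h_ptw h_gamma h_incr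
      fun E v hfin hlim => ?_
    obtain ⟨F, hF, hFv⟩ := exists_isNSet_cheegerConstant_le hΩ
      (E := fun n => (E n).1) (fun n => (E n).2) hfin hlim
    exact ⟨⟨F, hF⟩, hFv⟩
  · simp only [geometricEigenvalue, if_neg hp.ne']
    refine tendsto_iInf_evalExt (fun (E : {E : Fin N → Set (EuclideanSpace ℝ (Fin d)) //
      IsNSet Ω E}) i => firstEigenvalue p (E.1 i)) h_equi h_ptw h_gamma h_incr
      fun E v hfin hlim => ?_
    obtain ⟨F, hF, hFv⟩ := exists_isNSet_firstEigenvalue_le hp hΩ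
      (E := fun n => (E n).1) (fun n => (E n).2) hfin hlim
    exact ⟨⟨F, hF⟩, hFv⟩

end Stability

end NCheeger

theorem mainTheorem8 {d N : ℕ} (hd : 1 ≤ d) (hN : 1 ≤ N)
    (Ω : Set (EuclideanSpace ℝ (Fin d))) (hΩ_ne : Ω.Nonempty)
    (hΩ_bdd : Bornology.IsBounded Ω) (hΩ_open : IsOpen Ω)
    (Φk : ℕ → (Fin N → ℝ≥0) → ℝ≥0) (Φ : (Fin N → ℝ≥0) → ℝ≥0)
    (h_equi : NCheeger.Equicoercive Φk)
    (h_ptw : ∀ v, Tendsto (fun k => Φk k v) atTop (𝓝 (Φ v)))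
    (h_gamma : NCheeger.GammaTendsto Φk Φ)
    (h_incr : Monotone Φ) :
    Tendsto (fun k => NCheeger.cheegerN (Φk k) Ω) atTop (𝓝 (NCheeger.cheegerN Φ Ω)) ∧
    (∀ p : ℝ, 1 ≤ p →
      Tendsto (fun k => NCheeger.functionalEigenvalue (Φk k) p Ω) atTop
        (𝓝 (NCheeger.functionalEigenvalue Φ p Ω))) ∧
    (∀ p : ℝ, 1 ≤ p →
      Tendsto (fun k => NCheeger.geometricEigenvalue (Φk k) p Ω) atTop
        (𝓝 (NCheeger.geometricEigenvalue Φ p Ω))) := by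
  exact ⟨NCheeger.tendsto_cheegerN hΩ_bdd h_equi h_ptw h_gamma h_incr,
    fun _ hp => NCheeger.tendsto_functionalEigenvalue hΩ_bdd h_equi h_ptw h_gamma h_incr hp,
    fun _ hp => NCheeger.tendsto_geometricEigenvalue hΩ_bdd h_equi h_ptw h_gamma h_incr hp⟩
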